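/- **Definitions.** Let $(X,d)$ be a metric space and $S\subseteq X$. A subset $T\subseteq S$ is an *$r$-cover* of $S$ if every $s\in S$ has some $t\in T$ with $d(s,t)\le r$. An *$m$-solidarity-$r$-cover* of $S$ consists of $m$ pairwise disjoint subsets of $S$, each of which is an $r$-cover of $S$. A *planar orthogonal drawing* of a finite simple graph $G=(V,E)$, $V=\{0,\dots,n-1\}$, places the vertices at distinct points of the integer grid and draws each edge as a simple path of horizontal and vertical unit segments between grid points, joining the positions of its endpoints, such that an edge passes through no vertex other than its endpoints and two distinct edges meet only at common endpoints. If the drawing lies on the grid $\{0,\dots,w-1\}\times\{0,\dots,h-1\}$, we say that it is drawn in area $w\cdot h$. The drawing is given as input by listing the positions of the vertices and, for each edge, the sequence of all grid points on its path, with coordinates in binary. **Lemma.** There is an algorithm (a deterministic multi-stack Turing machine) such that for every constant $C\in\mathbb N$ there is a polynomial $p$ for which the following holds. Given any planar orthogonal drawing, in area at most $C|V|^2$, of a finite simple graph $G=(V,E)$, the algorithm halts after at most $p(|V|)$ steps and outputs a list of points with rational coordinates (written in binary as reduced fractions), whose set $S\subset\mathbb R^2$, with the Euclidean metric, satisfies: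 for every real $r$ with $1\le r<\sqrt2$, $S$ has a $3$-solidarity-$r$-cover if and only if $G$ is $3$-colorable. -/

import Mathlib

/-! ### Solidarity covers -/

/-- `T ⊆ S` is an `r`-cover of `S`: every point of `S` is within distance `r` of a point of `T`. -/
def IsRCover {X : Type*} [MetricSpace X] (S : Set X) (r : ℝ) (T : Set X) : Prop :=
  T ⊆ S ∧ ∀ s ∈ S, ∃ t ∈ T, dist s t ≤ r

/-- `S` has an `m`-solidarity-`r`-cover: `m` pairwise disjoint subsets of `S`, each of which is an
`r`-cover of `S`. -/
def HasSolidarityCover {X : Type*} [MetricSpace X] (S : Set X) (m : ℕ) (r : ℝ) : Prop :=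
  ∃ T : Fin m → Set X, Pairwise (fun i j => Disjoint (T i) (T j)) ∧ ∀ i, IsRCover S r (T i)

/-! ### Planar orthogonal grid drawings -/

/-- The endpoints of a horizontal or vertical unit segment of the integer grid. -/
def GridStep (p q : ℕ × ℕ) : Prop :=
  (p.2 = q.2 ∧ (p.1 + 1 = q.1 ∨ q.1 + 1 = p.1)) ∨
  (p.1 = q.1 ∧ (p.2 + 1 = q.2 ∨ q.2 + 1 = p.2))

/-- `u v` is an edge of `G`, listed with its smaller endpoint first. -/
def IsOrderedEdge {n : ℕ} (G : SimpleGraph (Fin n)) (u v : Fin n) : Prop :=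
  u < v ∧ G.Adj u v

/-- A planar orthogonal drawing of `G` on the integer grid. Vertices are placed at distinct grid
points, and an edge `u v` (with `u < v`) is drawn as a simple path of horizontal and vertical unit
segments, given by the sequence `route u v` of all grid points on it, from the position of `u` to
the position of `v`. The drawing is plane: an edge passes through no vertex other than its two
endpoints, and two distinct edges meet at most at the position of a vertex (which is then an
endpoint of both). For pairs `u v` that are not of this form `route u v` has no meaning. -/
structure OrthogonalDrawing {n : ℕ} (G : SimpleGraph (Fin n)) where
  pos : Fin n → ℕ × ℕ
  route : Fin n → Fin n → List (ℕ × ℕ)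
  pos_injective : Function.Injective pos
  route_head : ∀ u v, IsOrderedEdge G u v → (route u v).head? = some (pos u)
  route_last : ∀ u v, IsOrderedEdge G u v → (route u v).getLast? = some (pos v)
  route_step : ∀ u v, IsOrderedEdge G u v → (route u v).IsChain GridStep
  route_simple : ∀ u v, IsOrderedEdge G u v → (route u v).Nodup
  route_avoids : ∀ u v, IsOrderedEdge G u v → ∀ w, pos w ∈ route u v → w = u ∨ w = v
  route_meet : ∀ u v u' v', IsOrderedEdge G u v → IsOrderedEdge G u' v' → (u, v) ≠ (u', v') →
    ∀ p, p ∈ route u v → p ∈ route u' v' → ∃ w, p = pos w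

/-- The whole drawing lies on the `w × h` grid `{0, …, w - 1} × {0, …, h - 1}`, whose area (number
of grid points) is `w * h`. -/
def OrthogonalDrawing.LiesOnGrid {n : ℕ} {G : SimpleGraph (Fin n)} (D : OrthogonalDrawing G)
    (w h : ℕ) : Prop :=
  (∀ v, (D.pos v).1 < w ∧ (D.pos v).2 < h) ∧
  ∀ u v, IsOrderedEdge G u v → ∀ p ∈ D.route u v, p.1 < w ∧ p.2 < h

/-! ### Encoding of the input and of the output, numbers being written in binary -/

/-- The alphabet used for input and output words. -/
inductive Letter where
  | bit (b : Bool)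
  | minus
  | slash
  | comma
  | semicolon
  | vertex
  | edge
  deriving DecidableEq, Fintype

/-- Binary digits of a natural number, least significant first. -/
def encodeNatural (k : ℕ) : List Letter := k.bits.map Letter.bit

/-- The grid point `(x, y)` is written `x,y;`. -/
def encodeGridPoint (p : ℕ × ℕ) : List Letter :=
  encodeNatural p.1 ++ [Letter.comma] ++ encodeNatural p.2 ++ [Letter.semicolon]

open Classical in
/-- The ordered edges of `G`, in lexicographic order. -/
noncomputable def orderedEdges {n : ℕ} (G : SimpleGraph (Fin n)) : List (Fin n × Fin n) :=
  (List.finRange n ×ˢ List.finRange n).filter (fun e => decide (IsOrderedEdge G e.1 e.2))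

/-- A drawing is written as the list of the positions of its vertices, followed by the list of the
grid paths of its edges. -/
noncomputable def OrthogonalDrawing.encode {n : ℕ} {G : SimpleGraph (Fin n)}
    (D : OrthogonalDrawing G) : List Letter :=
  (List.finRange n).flatMap (fun v => Letter.vertex :: encodeGridPoint (D.pos v)) ++
  (orderedEdges G).flatMap (fun e => Letter.edge :: (D.route e.1 e.2).flatMap encodeGridPoint)

/-- A rational number is written as its reduced fraction `a/b` or `-a/b`. -/
def encodeRational (q : ℚ) : List Letter :=
  (if q < 0 then [Letter.minus] else []) ++ encodeNatural q.num.natAbs ++ [Letter.slash] ++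
    encodeNatural q.den

/-- A list of points with rational coordinates is written `x₁,y₁;x₂,y₂;…`. -/
def encodePoints (L : List (ℚ × ℚ)) : List Letter :=
  L.flatMap (fun p =>
    encodeRational p.1 ++ [Letter.comma] ++ encodeRational p.2 ++ [Letter.semicolon])

/-- The finite subset of the Euclidean plane listed by `L`. -/
def planeSet (L : List (ℚ × ℚ)) : Set (EuclideanSpace ℝ (Fin 2)) :=
  {x | ∃ p ∈ L, x = !₂[(p.1 : ℝ), (p.2 : ℝ)]}

/-! ### Computation -/

/-- The (multi-stack) Turing machine `M`, started on the word `input`, halts with exactly the word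
`output` written after at most `t` steps. -/
def HaltsWithOutputIn {A B : Type} (M : Turing.TM2ComputableAux A B) (input : List A)
    (output : List B) (t : ℕ) : Prop :=
  Nonempty (Turing.TM2OutputsInTime M.tm (input.map M.inputAlphabet.symm)
    (some (output.map M.outputAlphabet.symm)) t)

/-! Squared distances between grid points are integers, so for `1 ≤ r < √2` two grid points are
within distance `r` exactly when they are equal or adjacent. A 3-solidarity cover of a set of grid
points is thus a partial 3-colouring in which every closed neighbourhood shows all three colours. A
point with exactly two neighbours forces three distinct colours on the three points (`colour_ne`),
so colours have period three along paths of such points.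

The drawing is enlarged by the factor 12. Each grid point used becomes the boundary of a square of
side 6. Its corners and side midpoints are three steps apart and share a colour, the colour of the
square (`colour_ring`). Each unit segment becomes a wire joining the facing midpoints of two
squares, at distance 6. A plain wire is a straight path and transmits the colour (`plain_wire`). A
special wire contains a cycle of eight points and forces its ends to differ (`special_wire`).
Conversely, finite checks show that squares and wires whose end colours obey these rules can be
coloured (`exists_isTriple`).

The first segment of each route is special and the others are plain, so adjacent vertices get
different colours (`colorable_of_isTriple`). Conversely, given a 3-colouring of `G`, every point of
a route except the first takes the colour of the last vertex. This is consistent because routes meet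
only at vertices (`exists_isTriple_of_colorable`).

Every output point has the form `(12 - j) • p + j • q + c`, where `p`, `q` are the last two points
read and `j`, `c` are small constants. It can be printed digit by digit with a carry of at most 12,
in a single pass over the input. The running time is quadratic in the input length
(`haltsWithOutputIn_machine`), which the area bound makes polynomial in `n` (`length_encode_le`). -/

/-! ### Structured programs for stack machines -/

/-- Structured programs acting on a finite register of type `σ` and on stacks, indexed by `K`, of
letters of type `A`. -/
inductive StackProg (K A σ : Type) where
  | pop (k : K) (f : σ → Option A → σ)
  | push (k : K) (f : σ → A)
  | load (f : σ → σ)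
  | seq (P Q : StackProg K A σ)
  | ite (c : σ → Bool) (P Q : StackProg K A σ)
  | loop (c : σ → Bool) (P : StackProg K A σ)

namespace StackProg

open Turing

variable {K A σ : Type}

/-- The labels of the machine code of a program. -/
def Label : StackProg K A σ → Type
  | pop _ _ => Unit
  | push _ _ => Unit
  | load _ => Unit
  | seq P Q => P.Label ⊕ Q.Label
  | ite _ P Q => Unit ⊕ (P.Label ⊕ Q.Label)
  | loop _ P => Unit ⊕ P.Label

/-- The label at which the execution of a program starts. -/
def entry : (P : StackProg K A σ) → P.Label
  | pop _ _ => ()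
  | push _ _ => ()
  | load _ => ()
  | seq P _ => Sum.inl P.entry
  | ite _ _ _ => Sum.inl ()
  | loop _ _ => Sum.inl ()

instance labelFintype : (P : StackProg K A σ) → Fintype P.Label
  | pop _ _ => inferInstanceAs (Fintype Unit)
  | push _ _ => inferInstanceAs (Fintype Unit)
  | load _ => inferInstanceAs (Fintype Unit)
  | seq P Q =>
    letI := labelFintype P
    letI := labelFintype Q
    inferInstanceAs (Fintype (P.Label ⊕ Q.Label))
  | ite _ P Q =>
    letI := labelFintype P
    letI := labelFintype Q
    inferInstanceAs (Fintype (Unit ⊕ (P.Label ⊕ Q.Label)))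
  | loop _ P =>
    letI := labelFintype P
    inferInstanceAs (Fintype (Unit ⊕ P.Label))

/-- Jump to a label, or halt. -/
def jump {Λ : Type} : Option Λ → TM2.Stmt (fun _ : K => A) Λ σ
  | none => TM2.Stmt.halt
  | some l => TM2.Stmt.goto fun _ => l

/-- The machine code of a program whose labels are embedded by `e` in the set of labels of a machine
and which continues, once it is finished, at `x`. -/
def code {Λ : Type} : (P : StackProg K A σ) → (P.Label → Λ) → Option Λ → P.Label →
    TM2.Stmt (fun _ : K => A) Λ σ
  | pop k f, _, x, _ => TM2.Stmt.pop k f (jump x)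
  | push k f, _, x, _ => TM2.Stmt.push k f (jump x)
  | load f, _, x, _ => TM2.Stmt.load f (jump x)
  | seq P Q, e, _, Sum.inl l =>
    P.code (fun l => e (Sum.inl l)) (some (e (Sum.inr Q.entry))) l
  | seq _ Q, e, x, Sum.inr l => Q.code (fun l => e (Sum.inr l)) x l
  | ite c P Q, e, _, Sum.inl _ =>
    TM2.Stmt.branch c (jump (some (e (Sum.inr (Sum.inl P.entry)))))
      (jump (some (e (Sum.inr (Sum.inr Q.entry)))))
  | ite _ P _, e, x, Sum.inr (Sum.inl l) => P.code (fun l => e (Sum.inr (Sum.inl l))) x l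
  | ite _ _ Q, e, x, Sum.inr (Sum.inr l) => Q.code (fun l => e (Sum.inr (Sum.inr l))) x l
  | loop c P, e, x, Sum.inl _ =>
    TM2.Stmt.branch c (jump (some (e (Sum.inr P.entry)))) (jump x)
  | loop _ P, e, _, Sum.inr l => P.code (fun l => e (Sum.inr l)) (some (e (Sum.inl ()))) l

/-! ### Execution of programs, with time bounds -/

variable [DecidableEq K]

/-- A configuration without its label. -/
abbrev State (K A σ : Type) := σ × (K → List A)

/-- The machine `M` gets from configuration `c` to configuration `c'` in at most `t` steps. -/
def Reaches {Λ : Type} (M : Λ → TM2.Stmt (fun _ : K => A) Λ σ)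
    (c c' : TM2.Cfg (fun _ : K => A) Λ σ) (t : ℕ) : Prop :=
  Nonempty (StateTransition.EvalsToInTime (TM2.step M) c (some c') t)

theorem Reaches.trans {Λ : Type} {M : Λ → TM2.Stmt (fun _ : K => A) Λ σ}
    {c₁ c₂ c₃ : TM2.Cfg (fun _ : K => A) Λ σ} {s t : ℕ} (h : Reaches M c₁ c₂ s)
    (h' : Reaches M c₂ c₃ t) : Reaches M c₁ c₃ (s + t) := by
  obtain ⟨a⟩ := h
  obtain ⟨b⟩ := h'
  rw [add_comm]
  exact ⟨a.trans _ _ _ _ _ _ b⟩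

theorem Reaches.mono {Λ : Type} {M : Λ → TM2.Stmt (fun _ : K => A) Λ σ}
    {c₁ c₂ : TM2.Cfg (fun _ : K => A) Λ σ} {s t : ℕ} (h : Reaches M c₁ c₂ s) (hst : s ≤ t) :
    Reaches M c₁ c₂ t := by
  obtain ⟨a⟩ := h
  exact ⟨⟨a.toEvalsTo, a.steps_le_m.trans hst⟩⟩

theorem Reaches.single {Λ : Type} {M : Λ → TM2.Stmt (fun _ : K => A) Λ σ} {l : Λ} {v : σ}
    {S : K → List A} {c : TM2.Cfg (fun _ : K => A) Λ σ} (h : TM2.stepAux (M l) v S = c) :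
    Reaches M ⟨some l, v, S⟩ c 1 :=
  ⟨⟨⟨1, by subst h; rfl⟩, le_rfl⟩⟩

/-- In every machine that contains the code of `P`, the program `P`, started in state `s`, is
finished after at most `t` steps, in state `s'`. -/
def Runs (P : StackProg K A σ) (s s' : State K A σ) (t : ℕ) : Prop :=
  ∀ (Λ : Type) (M : Λ → TM2.Stmt (fun _ : K => A) Λ σ) (e : P.Label → Λ) (x : Option Λ),
    (∀ l, M (e l) = P.code e x l) → Reaches M ⟨some (e P.entry), s.1, s.2⟩ ⟨x, s'.1, s'.2⟩ t

theorem stepAux_jump {Λ : Type} (x : Option Λ) (v : σ) (S : K → List A) :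
    TM2.stepAux (jump x) v S = ⟨x, v, S⟩ := by
  cases x <;> rfl

theorem Runs.mono {P : StackProg K A σ} {s s' : State K A σ} {t t' : ℕ} (h : P.Runs s s' t)
    (ht : t ≤ t') : P.Runs s s' t' :=
  fun Λ M e x hM => (h Λ M e x hM).mono ht

theorem runs_pop (k : K) (f : σ → Option A → σ) (s : State K A σ) :
    (pop k f).Runs s (f s.1 (s.2 k).head?, Function.update s.2 k (s.2 k).tail) 1 :=
  fun _ _ _ x hM => Reaches.single (by rw [hM]; exact stepAux_jump x _ _)

theorem runs_push (k : K) (f : σ → A) (s : State K A σ) :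
    (push k f).Runs s (s.1, Function.update s.2 k (f s.1 :: s.2 k)) 1 :=
  fun _ _ _ x hM => Reaches.single (by rw [hM]; exact stepAux_jump x _ _)

theorem runs_load (f : σ → σ) (s : State K A σ) : (load f).Runs s (f s.1, s.2) 1 :=
  fun _ _ _ x hM => Reaches.single (by rw [hM]; exact stepAux_jump x _ _)

/-- Since `Runs` quantifies over all host machines and all continuations, `P` may be taken with the
entry of `Q` as its exit. -/
theorem Runs.seq {P Q : StackProg K A σ} {s s' s'' : State K A σ} {t t' : ℕ} (h : P.Runs s s' t)
    (h' : Q.Runs s' s'' t') : (P.seq Q).Runs s s'' (t + t') := by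
  intro Λ M e x hM
  exact (h Λ M _ _ fun l => hM (Sum.inl l)).trans (h' Λ M _ _ fun l => hM (Sum.inr l))

theorem Runs.ite_true {c : σ → Bool} {P Q : StackProg K A σ} {s s' : State K A σ} {t : ℕ}
    (hc : c s.1 = true) (h : P.Runs s s' t) : (ite c P Q).Runs s s' (1 + t) := by
  intro Λ M e x hM
  refine Reaches.trans (Reaches.single ?_) (h Λ M _ _ fun l => hM (Sum.inr (Sum.inl l)))
  rw [hM]
  simp [entry, code, hc, jump]

theorem Runs.ite_false {c : σ → Bool} {P Q : StackProg K A σ} {s s' : State K A σ} {t : ℕ}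
    (hc : c s.1 = false) (h : Q.Runs s s' t) : (ite c P Q).Runs s s' (1 + t) := by
  intro Λ M e x hM
  refine Reaches.trans (Reaches.single ?_) (h Λ M _ _ fun l => hM (Sum.inr (Sum.inr l)))
  rw [hM]
  simp [entry, code, hc, jump]

theorem runs_loop_done {c : σ → Bool} {P : StackProg K A σ} {s : State K A σ}
    (hc : c s.1 = false) : (loop c P).Runs s s 1 := by
  intro Λ M e x hM
  refine Reaches.single ?_
  rw [hM]
  simp [entry, code, hc, stepAux_jump]

theorem Runs.loop_step {c : σ → Bool} {P : StackProg K A σ} {s s' s'' : State K A σ} {t t' : ℕ}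
    (hc : c s.1 = true) (h : P.Runs s s' t) (h' : (loop c P).Runs s' s'' t') :
    (loop c P).Runs s s'' (1 + (t + t')) := by
  intro Λ M e x hM
  refine Reaches.trans (Reaches.single ?_)
    ((h Λ M _ _ fun l => hM (Sum.inr l)).trans (h' Λ M e x hM))
  rw [hM]
  simp [entry, code, hc, jump]

/-- The sequential execution of a list of programs. -/
def seqs : List (StackProg K A σ) → StackProg K A σ
  | [] => load id
  | P :: l => P.seq (seqs l)

theorem runs_seqs_nil (s : State K A σ) : (seqs [] : StackProg K A σ).Runs s s 1 :=
  runs_load id s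

/-- The machine that runs a program and halts. -/
def toFinTM2 [Fintype K] [Fintype A] [Fintype σ] (P : StackProg K A σ) (k₀ k₁ : K) (v : σ) :
    FinTM2 where
  K := K
  k₀ := k₀
  k₁ := k₁
  Γ := fun _ => A
  Λ := P.Label
  main := P.entry
  σ := σ
  initialState := v
  Γk₀Fin := inferInstanceAs (Fintype A)
  m := P.code id none

/-- A halting configuration must have the initial register and empty stacks apart from the output;
hence `v` occurs on both sides. -/
theorem outputsInTime [Fintype K] [Fintype A] [Fintype σ] (P : StackProg K A σ) (k₀ k₁ : K) (v : σ)
    {a b : List A} {t : ℕ}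
    (h : P.Runs (v, Function.update (fun _ => []) k₀ a) (v, Function.update (fun _ => []) k₁ b) t) :
    Nonempty (TM2OutputsInTime (P.toFinTM2 k₀ k₁ v) a (some b) t) := by
  have key := h P.Label (P.code id none) id none fun _ => rfl
  have h₀ : initList (P.toFinTM2 k₀ k₁ v) a =
      (⟨some P.entry, v, Function.update (fun _ => []) k₀ a⟩ :
        TM2.Cfg (fun _ : K => A) P.Label σ) := by
    unfold initList
    refine congrArg (TM2.Cfg.mk (some P.entry) v) (funext fun k : K => ?_)
    by_cases hk : k = k₀
    · exact (dif_pos hk).trans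
        (show a = Function.update (fun _ => ([] : List A)) k₀ a k by rw [hk, Function.update_self])
    · exact (dif_neg hk).trans (Function.update_of_ne hk _ fun _ : K => ([] : List A)).symm
  have h₁ : haltList (P.toFinTM2 k₀ k₁ v) b =
      (⟨none, v, Function.update (fun _ => []) k₁ b⟩ :
        TM2.Cfg (fun _ : K => A) P.Label σ) := by
    unfold haltList
    refine congrArg (TM2.Cfg.mk none v) (funext fun k : K => ?_)
    by_cases hk : k = k₁
    · exact (dif_pos hk).trans
        (show b = Function.update (fun _ => ([] : List A)) k₁ b k by rw [hk, Function.update_self])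
    · exact (dif_neg hk).trans (Function.update_of_ne hk _ fun _ : K => ([] : List A)).symm
  obtain ⟨e⟩ := key
  refine ⟨⟨⟨e.steps, ?_⟩, e.steps_le_m⟩⟩
  rw [h₀]
  exact e.evals_in_steps.trans (congrArg some h₁.symm)

end StackProg

/-! ### The machine -/

namespace CoverReduction

open StackProg

/-- The stacks: input, output, one stack for each of the two coordinates, and two auxiliary
stacks. -/
inductive Stack where
  | inp
  | out
  | coord (b : Bool)
  | aux
  | tmp
  deriving DecidableEq, Fintype

/-- What is being read: a vertex, or the first, the second or a later point of a route. -/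
inductive Phase where
  | vertex
  | routeStart
  | routeFirst
  | routeRest
  deriving DecidableEq

instance : Fintype Phase :=
  ⟨{.vertex, .routeStart, .routeFirst, .routeRest}, fun φ => by cases φ <;> decide⟩

/-- The phase after a point has been read. -/
def Phase.next : Phase → Phase
  | vertex => vertex
  | routeStart => routeFirst
  | routeFirst => routeRest
  | routeRest => routeRest

/-- The register: the next letter of the input, the letter popped last from another stack, a carry,
and the phase. -/
structure Reg where
  inp : Option Letter
  tmp : Option Letter
  carry : Fin 32
  phase : Phase
  deriving DecidableEq, Fintype

abbrev Prog := StackProg Stack Letter Reg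

/-- The contents of the stacks. -/
def mem (I O S T : List Letter) (Z : Bool → List Letter) : Stack → List Letter
  | Stack.inp => I
  | Stack.out => O
  | Stack.coord b => Z b
  | Stack.aux => S
  | Stack.tmp => T

@[simp] theorem mem_inp (I O S T Z) : mem I O S T Z Stack.inp = I := rfl
@[simp] theorem mem_out (I O S T Z) : mem I O S T Z Stack.out = O := rfl
@[simp] theorem mem_coord (I O S T Z b) : mem I O S T Z (Stack.coord b) = Z b := rfl
@[simp] theorem mem_aux (I O S T Z) : mem I O S T Z Stack.aux = S := rfl
@[simp] theorem mem_tmp (I O S T Z) : mem I O S T Z Stack.tmp = T := rfl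

@[simp] theorem update_inp (I O S T Z l) :
    Function.update (mem I O S T Z) Stack.inp l = mem l O S T Z := by
  funext k; cases k <;> simp [Function.update, mem]

@[simp] theorem update_out (I O S T Z l) :
    Function.update (mem I O S T Z) Stack.out l = mem I l S T Z := by
  funext k; cases k <;> simp [Function.update, mem]

@[simp] theorem update_coord (I O S T Z b l) :
    Function.update (mem I O S T Z) (Stack.coord b) l =
      mem I O S T (Function.update Z b l) := by
  funext k; cases k <;> simp [Function.update, mem]

@[simp] theorem update_aux (I O S T Z l) :
    Function.update (mem I O S T Z) Stack.aux l = mem I O l T Z := by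
  funext k; cases k <;> simp [Function.update, mem]

@[simp] theorem update_tmp (I O S T Z l) :
    Function.update (mem I O S T Z) Stack.tmp l = mem I O S l Z := by
  funext k; cases k <;> simp [Function.update, mem]

/-- The state in which the word `w` is still to be read. -/
def conf (w : List Letter) (t : Option Letter) (c : Fin 32) (φ : Phase) (O S T : List Letter)
    (Z : Bool → List Letter) : State Stack Letter Reg :=
  (⟨w.head?, t, c, φ⟩, mem w.tail O S T Z)

/-- Read the next letter of the input. -/
abbrev popInp : Prog := .pop .inp fun r a => { r with inp := a }

/-- Pop a letter from the stack `k`. -/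
abbrev popTmp (k : Stack) : Prog := .pop k fun r a => { r with tmp := a }

theorem runs_popInp (w t c φ O S T Z) :
    popInp.Runs (conf w t c φ O S T Z) (conf w.tail t c φ O S T Z) 1 := by
  simpa [conf] using runs_pop Stack.inp (fun r a => { r with inp := a }) (conf w t c φ O S T Z)

theorem runs_popTmp_coord (b w t c φ O S T Z) :
    (popTmp (.coord b)).Runs (conf w t c φ O S T Z)
      (conf w (Z b).head? c φ O S T (Function.update Z b (Z b).tail)) 1 := by
  simpa [conf] using
    runs_pop (.coord b) (fun r a => { r with tmp := a }) (conf w t c φ O S T Z)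

theorem runs_popTmp_aux (w t c φ O S T Z) :
    (popTmp .aux).Runs (conf w t c φ O S T Z) (conf w S.head? c φ O S.tail T Z) 1 := by
  simpa [conf] using runs_pop .aux (fun r a => { r with tmp := a }) (conf w t c φ O S T Z)

theorem runs_popTmp_tmp (w t c φ O S T Z) :
    (popTmp .tmp).Runs (conf w t c φ O S T Z) (conf w T.head? c φ O S T.tail Z) 1 := by
  simpa [conf] using runs_pop .tmp (fun r a => { r with tmp := a }) (conf w t c φ O S T Z)

theorem runs_push_out (f w t c φ O S T Z) :
    (StackProg.push .out f : Prog).Runs (conf w t c φ O S T Z)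
      (conf w t c φ (f ⟨w.head?, t, c, φ⟩ :: O) S T Z) 1 := by
  simpa [conf] using runs_push .out f (conf w t c φ O S T Z)

theorem runs_push_coord (b f w t c φ O S T Z) :
    (StackProg.push (.coord b) f : Prog).Runs (conf w t c φ O S T Z)
      (conf w t c φ O S T (Function.update Z b (f ⟨w.head?, t, c, φ⟩ :: Z b))) 1 := by
  simpa [conf] using runs_push (.coord b) f (conf w t c φ O S T Z)

theorem runs_push_aux (f w t c φ O S T Z) :
    (StackProg.push .aux f : Prog).Runs (conf w t c φ O S T Z)
      (conf w t c φ O (f ⟨w.head?, t, c, φ⟩ :: S) T Z) 1 := by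
  simpa [conf] using runs_push .aux f (conf w t c φ O S T Z)

theorem runs_push_tmp (f w t c φ O S T Z) :
    (StackProg.push .tmp f : Prog).Runs (conf w t c φ O S T Z)
      (conf w t c φ O S (f ⟨w.head?, t, c, φ⟩ :: T) Z) 1 := by
  simpa [conf] using runs_push .tmp f (conf w t c φ O S T Z)

theorem runs_load_carry (f : Reg → Fin 32) (w t c φ O S T Z) :
    (StackProg.load fun r => { r with carry := f r } : Prog).Runs (conf w t c φ O S T Z)
      (conf w t (f ⟨w.head?, t, c, φ⟩) φ O S T Z) 1 :=
  runs_load _ _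

theorem runs_load_phase (f : Reg → Phase) (w t c φ O S T Z) :
    (StackProg.load fun r => { r with phase := f r } : Prog).Runs (conf w t c φ O S T Z)
      (conf w t c (f ⟨w.head?, t, c, φ⟩) O S T Z) 1 :=
  runs_load _ _

/-! #### Moving words between stacks -/

/-- Move the contents of the stack `k` on top of the stack `k'`. -/
abbrev drain (k k' : Stack) : Prog :=
  .loop (fun r => r.tmp.isSome) (.seq (.push k' fun r => r.tmp.getD .comma) (popTmp k))

/-- The loop tests the letter popped last, so the word `l` still to be moved is split: its head is
in the register, its tail on the stack. The other loops use the same invariant. -/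
theorem runs_drain_aux (b w c φ O T) (l : List Letter) (Z) :
    (drain .aux (.coord b)).Runs (conf w l.head? c φ O l.tail T Z)
      (conf w none c φ O [] T (Function.update Z b (l.reverse ++ Z b))) (3 * l.length + 1) := by
  induction l generalizing Z with
  | nil => simpa using runs_loop_done (by simp [conf])
  | cons a l ih =>
    refine (Runs.loop_step (by simp [conf])
      ((runs_push_coord b _ _ _ _ _ _ _ _ _).seq (runs_popTmp_aux _ _ _ _ _ _ _ _)) ?_).mono
      (t := 1 + (2 + (3 * l.length + 1))) (by simp; omega)
    simpa using ih (Function.update Z b (a :: Z b))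

theorem runs_drain_tmp (w c φ O S) (l : List Letter) (Z) :
    (drain .tmp .out).Runs (conf w l.head? c φ O S l.tail Z)
      (conf w none c φ (l.reverse ++ O) S [] Z) (3 * l.length + 1) := by
  induction l generalizing O with
  | nil => simpa using runs_loop_done (by simp [conf])
  | cons a l ih =>
    refine (Runs.loop_step (by simp [conf])
      ((runs_push_out _ _ _ _ _ _ _ _ _).seq (runs_popTmp_tmp _ _ _ _ _ _ _ _)) ?_).mono
      (t := 1 + (2 + (3 * l.length + 1))) (by simp; omega)
    simpa using ih (a :: O)

/-- Remove the letters `bit false` from the top of the stack `tmp`. -/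
abbrev strip : Prog := .loop (fun r => r.tmp = some (.bit false)) (popTmp .tmp)

theorem runs_strip (w c φ O S) (l : List Letter) (Z) :
    strip.Runs (conf w l.head? c φ O S l.tail Z)
      (conf w (l.dropWhile (· = .bit false)).head? c φ O S
        (l.dropWhile (· = .bit false)).tail Z) (2 * l.length + 1) := by
  induction l with
  | nil => simpa using runs_loop_done (by simp [conf])
  | cons a l ih =>
    by_cases ha : a = .bit false
    · refine (Runs.loop_step (by simp [conf, ha]) (runs_popTmp_tmp _ _ _ _ _ _ _ _) ?_).mono
        (t := 1 + (1 + (2 * l.length + 1))) (by simp; omega)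
      simpa [ha] using ih
    · refine Runs.mono (t := 1) ?_ (by omega)
      simpa [List.dropWhile_cons, ha] using
        runs_loop_done (P := popTmp .tmp) (s := conf w (some a) c φ O S l Z)
          (c := fun r => r.tmp = some (.bit false)) (by simp [conf, ha])

/-- Erase the stack `coord b`. -/
abbrev clear (b : Bool) : Prog :=
  .seq (popTmp (.coord b)) (.loop (fun r => r.tmp.isSome) (popTmp (.coord b)))

theorem runs_clear (b w t c φ O S T Z) :
    (clear b).Runs (conf w t c φ O S T Z) (conf w none c φ O S T (Function.update Z b []))
      (2 * (Z b).length + 2) := by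
  have key : ∀ (l : List Letter) (Z : Bool → List Letter), Z b = l.tail →
      (loop (fun r => r.tmp.isSome) (popTmp (.coord b)) : Prog).Runs
        (conf w l.head? c φ O S T Z) (conf w none c φ O S T (Function.update Z b []))
        (2 * l.length + 1) := by
    intro l
    induction l with
    | nil =>
      intro Z hZ
      have : Function.update Z b [] = Z := by simpa using hZ
      rw [this]
      exact runs_loop_done (by simp [conf])
    | cons a l ih =>
      intro Z hZ
      refine (Runs.loop_step (by simp [conf]) (runs_popTmp_coord b _ _ _ _ _ _ _ _) ?_).mono
        (t := 1 + (1 + (2 * l.length + 1))) (by simp; omega)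
      have := ih (Function.update Z b (Z b).tail) (by simp [hZ])
      simpa [hZ] using this
  have h := (runs_popTmp_coord b w t c φ O S T Z).seq
    (key (Z b) (Function.update Z b (Z b).tail) (by simp))
  simp only [Function.update_idem] at h
  exact h.mono (by omega)

/-! #### Reading a coordinate -/

def isBit : Option Letter → Bool
  | some (.bit _) => true
  | _ => false

def bitOf : Option Letter → Bool
  | some (.bit b) => b
  | _ => false

/-- The letters that represent pairs of bits on the stacks for the coordinates. -/
def pairLetter : Bool × Bool → Letter
  | (false, false) => .bit false
  | (false, true) => .bit true
  | (true, false) => .minus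
  | (true, true) => .slash

/-- An exhausted stack (`none`) counts as a pair of zero digits, which pads the shorter number. -/
def unpair : Option Letter → Bool × Bool
  | some (.bit true) => (false, true)
  | some .minus => (true, false)
  | some .slash => (true, true)
  | _ => (false, false)

@[simp] theorem unpair_pairLetter (p : Bool × Bool) : unpair (some (pairLetter p)) = p := by
  obtain ⟨_ | _, _ | _⟩ := p <;> rfl

@[simp] theorem unpair_none : unpair none = (false, false) := rfl

/-- Replace the pairs `(p, q)` by `(q, r)`, where the bits `r` are given. -/
def shift : List (Bool × Bool) → List Bool → List (Bool × Bool)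
  | [], [] => []
  | [], b :: l => (false, b) :: shift [] l
  | x :: xs, [] => (x.2, false) :: shift xs []
  | x :: xs, b :: l => (x.2, b) :: shift xs l

theorem length_shift (xs : List (Bool × Bool)) (l : List Bool) :
    (shift xs l).length = max xs.length l.length := by
  fun_induction shift xs l <;> simp_all

/-- Read a number and the letter that follows it. -/
abbrev readCoord (b : Bool) : Prog :=
  .seq (popTmp (.coord b)) <|
  .seq (.loop (fun r => isBit r.inp || r.tmp.isSome) <|
    .seq (.push .aux fun r => pairLetter ((unpair r.tmp).2, bitOf r.inp)) <|
    .seq (popTmp (.coord b)) (.ite (fun r => isBit r.inp) popInp (.load id))) <|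
  .seq (popTmp .aux) <|
  .seq (drain .aux (.coord b)) popInp

/-- The loop continues until both the new number and the stored pairs are exhausted, at five steps
per pair. The new pairs end up reversed on `aux`; draining them back restores the order. -/
theorem runs_readCoord_loop (b a w c φ O T) (ha : isBit (some a) = false)
    (xs : List (Bool × Bool)) (l : List Bool) (S) (Z : Bool → List Letter)
    (hZ : Z b = (xs.map pairLetter).tail) :
    (StackProg.loop (fun r => isBit r.inp || r.tmp.isSome) <|
      .seq (.push .aux fun r => pairLetter ((unpair r.tmp).2, bitOf r.inp)) <|
      .seq (popTmp (.coord b)) (.ite (fun r => isBit r.inp) popInp (.load id)) : Prog).Runs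
      (conf (l.map .bit ++ a :: w) (xs.map pairLetter).head? c φ O S T Z)
      (conf (a :: w) none c φ O (((shift xs l).map pairLetter).reverse ++ S) T
        (Function.update Z b [])) (5 * (shift xs l).length + 1) := by
  have ha' : bitOf (some a) = false := by cases a <;> simp_all [isBit, bitOf]
  fun_induction shift xs l generalizing S Z with
  | case1 =>
    have : Function.update Z b [] = Z := by simpa using hZ
    rw [this]
    exact runs_loop_done (by simp [conf, ha])
  | case2 x l ih =>
    refine (Runs.loop_step (by simp [conf, isBit])
      ((runs_push_aux _ _ _ _ _ _ _ _ _).seq ((runs_popTmp_coord b _ _ _ _ _ _ _ _).seq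
        (Runs.ite_true (by simp [conf, isBit]) (runs_popInp _ _ _ _ _ _ _ _)))) ?_).mono
      (t := 1 + (4 + (5 * (shift [] l).length + 1))) (by simp; omega)
    simpa [hZ, bitOf] using ih (pairLetter (false, x) :: S) (Function.update Z b []) (by simp)
  | case3 x xs ih =>
    refine (Runs.loop_step (by simp [conf])
      ((runs_push_aux _ _ _ _ _ _ _ _ _).seq ((runs_popTmp_coord b _ _ _ _ _ _ _ _).seq
        (Runs.ite_false (by simp [conf, ha]) (runs_load _ _)))) ?_).mono
      (t := 1 + (4 + (5 * (shift xs []).length + 1))) (by simp; omega)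
    simpa [hZ, conf, ha'] using ih (pairLetter (x.2, false) :: S)
      (Function.update Z b (xs.map pairLetter).tail) (by simp)
  | case4 x xs y l ih =>
    refine (Runs.loop_step (by simp [conf])
      ((runs_push_aux _ _ _ _ _ _ _ _ _).seq ((runs_popTmp_coord b _ _ _ _ _ _ _ _).seq
        (Runs.ite_true (by simp [conf, isBit]) (runs_popInp _ _ _ _ _ _ _ _)))) ?_).mono
      (t := 1 + (4 + (5 * (shift xs l).length + 1))) (by simp; omega)
    simpa [hZ, bitOf] using ih (pairLetter (x.2, y) :: S)
      (Function.update Z b (xs.map pairLetter).tail) (by simp)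

theorem runs_readCoord (b a w t c φ O T) (ha : isBit (some a) = false)
    (xs : List (Bool × Bool)) (l : List Bool) (Z : Bool → List Letter)
    (hZ : Z b = xs.map pairLetter) :
    (readCoord b).Runs (conf (l.map .bit ++ a :: w) t c φ O [] T Z)
      (conf w none c φ O [] T (Function.update Z b ((shift xs l).map pairLetter)))
      (8 * (shift xs l).length + 5) := by
  have h₁ := runs_popTmp_coord b (l.map .bit ++ a :: w) t c φ O [] T Z
  have h₂ := runs_readCoord_loop b a w c φ O T ha xs l [] (Function.update Z b (Z b).tail)
    (by simp [hZ])
  rw [← hZ] at h₂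
  have h₃ := runs_popTmp_aux (a :: w) none c φ O
    (((shift xs l).map pairLetter).reverse ++ []) T
    (Function.update (Function.update Z b (Z b).tail) b [])
  have h₄ := runs_drain_aux b (a :: w) c φ O T
    (((shift xs l).map pairLetter).reverse ++ [])
    (Function.update (Function.update Z b (Z b).tail) b [])
  have h₅ := runs_popInp (a :: w) none c φ O [] T
    (Function.update Z b ((shift xs l).map pairLetter))
  simp only [List.append_nil, List.reverse_reverse, Function.update_self, Function.update_idem,
    List.length_reverse, List.length_map] at h₂ h₃ h₄
  exact (h₁.seq (h₂.seq (h₃.seq (h₄.seq h₅)))).mono (by omega)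

/-! #### Printing a coordinate -/

/-- The number with the given binary digits, least significant first. -/
def numeral : List Bool → ℕ
  | [] => 0
  | b :: l => b.toNat + 2 * numeral l

theorem numeral_bits (n : ℕ) : numeral n.bits = n := by
  induction n using Nat.binaryRec' with
  | zero => simp [numeral]
  | bit b n h ih =>
    rw [Nat.bits_append_bit _ _ h, numeral, ih, Nat.bit_val]
    omega

/-- A binary expansion is determined by its value up to zeros at the most significant end. Padding
creates such zeros, which the output format forbids. -/
theorem rdropWhile_not (l : List Bool) : l.rdropWhile (· = false) = (numeral l).bits := by
  induction l with
  | nil => simp [numeral]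
  | cons b l ih =>
    have h : numeral (b :: l) = Nat.bit b (numeral l) := by rw [Nat.bit_val, numeral]; omega
    have h' : (b :: l).rdropWhile (· = false) =
        if l.rdropWhile (· = false) = [] then (if b = false then [] else [b])
          else b :: l.rdropWhile (· = false) := by
      simp only [List.rdropWhile, List.reverse_cons, List.dropWhile_append]
      by_cases hl : (l.reverse.dropWhile (· = false)) = []
      · simp only [hl, List.isEmpty_nil, if_true, List.reverse_nil]
        cases b <;> rfl
      · simp only [List.isEmpty_eq_false_iff.2 hl, List.reverse_eq_nil_iff, hl, if_false,
          Bool.false_eq_true, List.reverse_append, List.reverse_singleton, List.singleton_append]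
    rw [h', ih, h]
    by_cases hn : numeral l = 0
    · cases b <;> simp [hn]
    · have : (numeral l).bits ≠ [] := fun h0 => hn (by rw [← numeral_bits (numeral l), h0]; rfl)
      rw [if_neg this, Nat.bits_append_bit _ _ fun h0 => absurd h0 hn]

/-- The bits of `(12 - j) * p + j * q + c`, where the bits of `p` and `q` are given as pairs. -/
def combination (j : ℕ) : List (Bool × Bool) → ℕ → List Bool
  | [], c => c.bits
  | x :: xs, c =>
    decide ((c + (12 - j) * x.1.toNat + j * x.2.toNat) % 2 = 1) ::
      combination j xs ((c + (12 - j) * x.1.toNat + j * x.2.toNat) / 2)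

theorem numeral_combination (j : ℕ) (xs : List (Bool × Bool)) (c : ℕ) :
    numeral (combination j xs c) =
      (12 - j) * numeral (xs.map Prod.fst) + j * numeral (xs.map Prod.snd) + c := by
  induction xs generalizing c with
  | nil => simp [combination, numeral_bits, numeral]
  | cons x xs ih =>
    simp only [combination, numeral, ih, List.map_cons]
    set s := c + (12 - j) * x.1.toNat + j * x.2.toNat with hs
    have : (decide (s % 2 = 1)).toNat = s % 2 := by
      rcases Nat.mod_two_eq_zero_or_one s with h | h <;> simp [h]
    rw [this]
    have := Nat.mod_add_div s 2
    linarith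

theorem length_bits_le (c : ℕ) : c.bits.length ≤ c := by
  rw [Nat.size_eq_bits_len, Nat.size_le]
  exact Nat.lt_two_pow_self

/-- The sum of the carry and of the contribution of the pair of bits popped last. -/
def total (j : ℕ) (r : Reg) : ℕ :=
  r.carry + (12 - j) * (unpair r.tmp).1.toNat + j * (unpair r.tmp).2.toNat

/-- One column contributes at most `(12 - j) + j = 12`; with a carry of at most 12 the sum is at
most 24, so the next carry is again at most 12 and fits into `Fin 32`. -/
theorem total_le {j c : ℕ} (hj : j ≤ 12) (hc : c ≤ 12) (x : Bool × Bool) :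
    (c + (12 - j) * x.1.toNat + j * x.2.toNat) / 2 ≤ 12 := by
  obtain ⟨_ | _, _ | _⟩ := x <;> simp <;> omega

/-- Print the sum bits for all pairs of bits on the stack `coord b`, moving these to `aux`. -/
def combineLoop (b : Bool) (j : ℕ) : Prog :=
  .loop (fun r => r.tmp.isSome) <|
    .seq (.push .tmp fun r => .bit (total j r % 2 = 1)) <|
    .seq (.push .aux fun r => r.tmp.getD .comma) <|
    .seq (.load fun r => { r with carry := Fin.ofNat 32 (total j r / 2) }) (popTmp (.coord b))

/-- Print the bits of the carry. -/
def carryLoop : Prog :=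
  .loop (fun r => r.carry ≠ 0) <|
    .seq (.push .tmp fun r => .bit (r.carry.val % 2 = 1))
      (.load fun r => { r with carry := Fin.ofNat 32 (r.carry.val / 2) })

theorem runs_carryLoop (w t φ O S T Z) (c : ℕ) (hc : c ≤ 12) :
    carryLoop.Runs (conf w t (Fin.ofNat 32 c) φ O S T Z)
      (conf w t 0 φ O S ((c.bits.map .bit).reverse ++ T) Z) (3 * c + 1) := by
  induction c using Nat.strong_induction_on generalizing T with
  | _ c ih =>
    have hv : (Fin.ofNat 32 c).val = c := by simp [Fin.ofNat]; omega
    rcases Nat.eq_zero_or_pos c with rfl | hpos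
    · exact (runs_loop_done (by simp [conf])).mono (by omega)
    · have hbits : c.bits = decide (c % 2 = 1) :: (c / 2).bits := by
        have h : c = Nat.bit (decide (c % 2 = 1)) (c / 2) := by
          rw [Nat.bit_val]
          rcases Nat.mod_two_eq_zero_or_one c with h | h <;> simp [h] <;> omega
        conv_lhs => rw [h]
        refine Nat.bits_append_bit _ _ fun h0 => ?_
        have : c = 1 := by omega
        simp [this]
      have hne : Fin.ofNat 32 c ≠ 0 := fun h => by
        rw [h] at hv; simp at hv; omega
      refine (Runs.loop_step (by simpa [conf] using hne)
        ((runs_push_tmp _ _ _ _ _ _ _ _ _).seq (runs_load_carry _ _ _ _ _ _ _ _ _))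
        ?_).mono (t := 1 + (2 + (3 * (c / 2) + 1))) (by omega)
      have := ih (c / 2) (by omega) (.bit (c % 2 = 1) :: T) (by omega)
      rw [hbits]
      change carryLoop.Runs _ _ _
      simpa [conf, Nat.mod_eq_of_lt (show c < 32 by omega)] using this

/-- The digits `l` are printed here; those of the remaining carry `c'` are left to `carryLoop`. -/
theorem runs_combineLoop (b w φ O) {j : ℕ} (hj : j ≤ 12) (xs : List (Bool × Bool)) (c : ℕ)
    (hc : c ≤ 12) (S T) (Z : Bool → List Letter) (hZ : Z b = (xs.map pairLetter).tail) :
    ∃ c' ≤ 12, ∃ l, combination j xs c = l ++ c'.bits ∧ (combineLoop b j).Runs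
      (conf w (xs.map pairLetter).head? (Fin.ofNat 32 c) φ O S T Z)
      (conf w none (Fin.ofNat 32 c') φ O ((xs.map pairLetter).reverse ++ S)
        ((l.map .bit).reverse ++ T) (Function.update Z b []))
      (5 * xs.length + 1) := by
  induction xs generalizing c S T Z with
  | nil =>
    refine ⟨c, hc, [], rfl, ?_⟩
    have : Function.update Z b [] = Z := by simpa using hZ
    rw [this]
    exact runs_loop_done (by simp [conf])
  | cons x xs ih =>
    obtain ⟨c', hc', l, hl, h⟩ := ih _ (total_le hj hc x) (pairLetter x :: S)
      (.bit ((c + (12 - j) * x.1.toNat + j * x.2.toNat) % 2 = 1) :: T)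
      (Function.update Z b (xs.map pairLetter).tail) (by simp)
    refine ⟨c', hc', _ :: l, by rw [combination, hl, List.cons_append], ?_⟩
    refine (Runs.loop_step (by simp [conf])
      ((runs_push_tmp _ _ _ _ _ _ _ _ _).seq ((runs_push_aux _ _ _ _ _ _ _ _ _).seq
        ((runs_load_carry _ _ _ _ _ _ _ _ _).seq
          (runs_popTmp_coord b _ _ _ _ _ _ _ _)))) ?_).mono
      (t := 1 + (4 + (5 * xs.length + 1))) (by simp; omega)
    change (combineLoop b j).Runs _ _ _
    simpa [hZ, total, Nat.mod_eq_of_lt (show c < 32 by omega)] using h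

/-- Print the number `(12 - j) * p + j * q + c`, where `p` and `q` are the two numbers on the stack
`coord b`. -/
abbrev emitCoord (b : Bool) (j c : ℕ) : Prog :=
  .seq (.load fun r => { r with carry := Fin.ofNat 32 c }) <|
  .seq (popTmp (.coord b)) <|
  .seq (combineLoop b j) <|
  .seq carryLoop <|
  .seq (popTmp .aux) <|
  .seq (drain .aux (.coord b)) <|
  .seq (popTmp .tmp) <|
  .seq strip (drain .tmp .out)

/-- The value of item `(j, c)` at the numbers represented by `xs`. -/
def value (xs : List (Bool × Bool)) (j c : ℕ) : ℕ :=
  (12 - j) * numeral (xs.map Prod.fst) + j * numeral (xs.map Prod.snd) + c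

theorem length_combination_le (j : ℕ) (hj : j ≤ 12) (xs : List (Bool × Bool)) (c : ℕ)
    (hc : c ≤ 12) : (combination j xs c).length ≤ xs.length + 12 := by
  induction xs generalizing c with
  | nil => simpa [combination] using (length_bits_le c).trans hc
  | cons x xs ih =>
    have := ih _ (total_le hj hc x)
    simp only [combination, List.length_cons]
    omega

theorem strip_combination (j : ℕ) (xs : List (Bool × Bool)) (c : ℕ) :
    (((combination j xs c).map Letter.bit).reverse.dropWhile (· = .bit false)).reverse =
      encodeNatural (value xs j c) := by
  rw [encodeNatural, value, ← numeral_combination, ← rdropWhile_not, List.rdropWhile,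
    List.map_reverse, ← List.map_reverse, List.dropWhile_map]
  congr 3
  funext b
  simp

/-- Digits are produced least significant first, so the most significant one ends on top of `tmp`.
There redundant zeros can be stripped, and draining to `out` puts the least significant digit in
front. The factor 13 is `5 + 3 + 2 + 3`: combining, restoring the pairs, stripping, draining. -/
theorem runs_emitCoord (b w t c₀ φ O) {j c : ℕ} (hj : j ≤ 12) (hc : c ≤ 12)
    (xs : List (Bool × Bool)) (Z : Bool → List Letter) (hZ : Z b = xs.map pairLetter) :
    (emitCoord b j c).Runs (conf w t c₀ φ O [] [] Z)
      (conf w none 0 φ (encodeNatural (value xs j c) ++ O) [] [] Z) (13 * xs.length + 110) := by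
  obtain ⟨c', hc', l, hl, h₃⟩ := runs_combineLoop b w φ O hj xs c hc [] []
    (Function.update Z b (Z b).tail) (by simp [hZ])
  have hlen := length_combination_le j hj xs c hc
  have h₁ := runs_load_carry (fun _ => Fin.ofNat 32 c) w t c₀ φ O [] [] Z
  have h₂ := runs_popTmp_coord b w t (Fin.ofNat 32 c) φ O [] [] Z
  rw [show (Z b).head? = (xs.map pairLetter).head? by rw [hZ]] at h₂
  have h₄ := runs_carryLoop w none φ O ((xs.map pairLetter).reverse ++ [])
    ((l.map .bit).reverse ++ []) (Function.update (Function.update Z b (Z b).tail) b []) c' hc'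
  have hT : (c'.bits.map Letter.bit).reverse ++ ((l.map Letter.bit).reverse ++ []) =
      ((combination j xs c).map Letter.bit).reverse := by simp [hl]
  rw [hT] at h₄
  have h₅ := runs_popTmp_aux w none 0 φ O ((xs.map pairLetter).reverse ++ [])
    ((combination j xs c).map Letter.bit).reverse
    (Function.update (Function.update Z b (Z b).tail) b [])
  have h₆ := runs_drain_aux b w 0 φ O ((combination j xs c).map Letter.bit).reverse
    ((xs.map pairLetter).reverse ++ []) (Function.update (Function.update Z b (Z b).tail) b [])
  have hZ' : Function.update (Function.update (Function.update Z b (Z b).tail) b []) b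
      (((xs.map pairLetter).reverse ++ []).reverse ++
        Function.update (Function.update Z b (Z b).tail) b [] b) = Z := by
    simp [← hZ]
  rw [hZ'] at h₆
  have h₇ := runs_popTmp_tmp w none 0 φ O [] ((combination j xs c).map Letter.bit).reverse Z
  have h₈ := runs_strip w 0 φ O [] ((combination j xs c).map Letter.bit).reverse Z
  have h₉ := runs_drain_tmp w 0 φ O []
    (((combination j xs c).map Letter.bit).reverse.dropWhile (· = .bit false)) Z
  rw [strip_combination] at h₉
  have hdrop := List.length_dropWhile_le (· = Letter.bit false)
    ((combination j xs c).map Letter.bit).reverse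
  refine (h₁.seq (h₂.seq (h₃.seq (h₄.seq (h₅.seq (h₆.seq (h₇.seq (h₈.seq h₉)))))))).mono ?_
  simp only [List.length_reverse, List.length_map, List.append_nil] at hdrop ⊢
  omega

end CoverReduction

namespace CoverReduction

open StackProg

/-! #### The main program -/

/-- An item `(j, a, b)` stands for the point `(12 - j) • p + j • q + (a, b)`, where `p` and `q` are
the last two points that have been read. -/
abbrev Item := ℕ × ℕ × ℕ

/-- The boundary of a square of side `6` at the last point. -/
def ringItems : List Item :=
  ((List.range 7 ×ˢ List.range 7).filter fun s => s.1 = 0 ∨ s.1 = 6 ∨ s.2 = 0 ∨ s.2 = 6).map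
    fun s => (12, s.1, s.2)

/-- A wire between the squares at the last two points, which forces equal colours. -/
def plainItems : List Item := (List.range 5).map fun i => (i + 4, 3, 3)

/-- A wire between the squares at the last two points, which forces different colours. -/
def specialItems : List Item :=
  [(4, 3, 3), (8, 3, 3), (6, 2, 2), (6, 2, 3), (6, 2, 4), (6, 3, 2), (6, 3, 4), (6, 4, 2),
    (6, 4, 3), (6, 4, 4)]

/-- The items that are printed when a point has been read. -/
def items : Phase → List Item
  | .vertex => ringItems
  | .routeStart => []
  | .routeFirst => specialItems ++ ringItems
  | .routeRest => plainItems ++ ringItems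

def itemPoint (p q : ℕ × ℕ) (i : Item) : ℕ × ℕ :=
  ((12 - i.1) * p.1 + i.1 * q.1 + i.2.1, (12 - i.1) * p.2 + i.1 * q.2 + i.2.2)

theorem items_bound : ∀ φ, ∀ i ∈ items φ, i.1 ≤ 12 ∧ i.2.1 ≤ 12 ∧ i.2.2 ≤ 12 := by
  intro φ
  cases φ <;> decide

theorem length_items_le (φ : Phase) : (items φ).length ≤ 40 := by
  cases φ <;> decide

/-- Print an item. -/
def emitItem (i : Item) : Prog :=
  .seq (.push .out fun _ => .semicolon) <|
  .seq (.push .out fun _ => .bit true) <|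
  .seq (.push .out fun _ => .slash) <|
  .seq (emitCoord true i.1 i.2.2) <|
  .seq (.push .out fun _ => .comma) <|
  .seq (.push .out fun _ => .bit true) <|
  .seq (.push .out fun _ => .slash) (emitCoord false i.1 i.2.1)

/-- The contents of the stacks for the coordinates. -/
def pairs (zs : Bool → List (Bool × Bool)) : Bool → List Letter :=
  fun b => (zs b).map pairLetter

def fstPoint (zs : Bool → List (Bool × Bool)) : ℕ × ℕ :=
  (numeral ((zs false).map Prod.fst), numeral ((zs true).map Prod.fst))

def sndPoint (zs : Bool → List (Bool × Bool)) : ℕ × ℕ :=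
  (numeral ((zs false).map Prod.snd), numeral ((zs true).map Prod.snd))

def toRat (p : ℕ × ℕ) : ℚ × ℚ := (p.1, p.2)

theorem encodeRational_natCast (n : ℕ) :
    encodeRational n = encodeNatural n ++ [.slash, .bit true] := by
  simp [encodeRational, encodeNatural]

theorem encodePoints_append (L L' : List (ℚ × ℚ)) :
    encodePoints (L ++ L') = encodePoints L ++ encodePoints L' := by
  simp [encodePoints]

/-- The output is a stack and is written from its end: the semicolon first, then the second
coordinate (`true`) before the first, each with its denominator 1 ahead of its numerator. -/
theorem runs_emitItem (w c φ O) (zs : Bool → List (Bool × Bool)) {M : ℕ}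
    (hM : ∀ b, (zs b).length ≤ M) (i : Item) (hi : i.1 ≤ 12 ∧ i.2.1 ≤ 12 ∧ i.2.2 ≤ 12) :
    (emitItem i).Runs (conf w none c φ O [] [] (pairs zs))
      (conf w none 0 φ
        (encodePoints [toRat (itemPoint (fstPoint zs) (sndPoint zs) i)] ++ O) [] [] (pairs zs))
      (26 * M + 226) := by
  have h := (runs_push_out (fun _ => .semicolon) w none c φ O [] [] (pairs zs)).seq <|
    (runs_push_out (fun _ => .bit true) w none c φ _ [] [] (pairs zs)).seq <|
    (runs_push_out (fun _ => .slash) w none c φ _ [] [] (pairs zs)).seq <|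
    (runs_emitCoord true w none c φ _ hi.1 hi.2.2 (zs true) (pairs zs) rfl).seq <|
    (runs_push_out (fun _ => .comma) w none 0 φ _ [] [] (pairs zs)).seq <|
    (runs_push_out (fun _ => .bit true) w none 0 φ _ [] [] (pairs zs)).seq <|
    (runs_push_out (fun _ => .slash) w none 0 φ _ [] [] (pairs zs)).seq <|
    runs_emitCoord false w none 0 φ _ hi.1 hi.2.1 (zs false) (pairs zs) rfl
  have h₁ := hM true
  have h₂ := hM false
  have hO : encodePoints [toRat (itemPoint (fstPoint zs) (sndPoint zs) i)] ++ O =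
      encodeNatural (value (zs false) i.1 i.2.1) ++ .slash :: .bit true :: .comma ::
        (encodeNatural (value (zs true) i.1 i.2.2) ++ .slash :: .bit true :: .semicolon :: O) := by
    simp [encodePoints, toRat, itemPoint, fstPoint, sndPoint, value]
    simp only [← Nat.cast_mul, ← Nat.cast_add, encodeRational_natCast]
    simp
  rw [hO]
  exact h.mono (by omega)

theorem runs_emitItems (w φ O) (zs : Bool → List (Bool × Bool)) {M : ℕ}
    (hM : ∀ b, (zs b).length ≤ M) (l : List Item)
    (hl : ∀ i ∈ l, i.1 ≤ 12 ∧ i.2.1 ≤ 12 ∧ i.2.2 ≤ 12) :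
    (seqs (l.map emitItem)).Runs (conf w none 0 φ O [] [] (pairs zs))
      (conf w none 0 φ
        (encodePoints (((l.map (itemPoint (fstPoint zs) (sndPoint zs))).reverse).map toRat) ++ O)
          [] [] (pairs zs))
      (l.length * (26 * M + 226) + 1) := by
  induction l generalizing O with
  | nil => simpa [encodePoints] using runs_seqs_nil _
  | cons i l ih =>
    have h := (runs_emitItem w 0 φ O zs hM i (hl i (by simp))).seq
      (ih _ fun i' hi' => hl i' (by simp [hi']))
    rw [← List.append_assoc, ← encodePoints_append] at h
    simp only [List.map_cons, List.reverse_cons, List.map_append, List.map_nil]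
    exact h.mono (by rw [List.length_cons, add_one_mul l.length]; omega)

/-- Read a point, print the items of the phase, and change the phase. -/
def readPoint : Prog :=
  .seq (readCoord false) <|
  .seq (readCoord true) <|
  .seq (.ite (fun r => r.phase = .vertex) (seqs ((items .vertex).map emitItem)) <|
    .ite (fun r => r.phase = .routeStart) (seqs ((items .routeStart).map emitItem)) <|
    .ite (fun r => r.phase = .routeFirst) (seqs ((items .routeFirst).map emitItem))
      (seqs ((items .routeRest).map emitItem))) <|
  .load fun r => { r with phase := r.phase.next }

/-- The bits of the last two points after the point `q` has been read. -/
def shiftPoint (zs : Bool → List (Bool × Bool)) (q : ℕ × ℕ) : Bool → List (Bool × Bool)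
  | false => shift (zs false) q.1.bits
  | true => shift (zs true) q.2.bits

theorem map_fst_shift (xs : List (Bool × Bool)) (l : List Bool) :
    numeral ((shift xs l).map Prod.fst) = numeral (xs.map Prod.snd) := by
  fun_induction shift xs l <;> simp_all [numeral]

theorem map_snd_shift (xs : List (Bool × Bool)) (l : List Bool) :
    numeral ((shift xs l).map Prod.snd) = numeral l := by
  fun_induction shift xs l <;> simp_all [numeral]

theorem fstPoint_shiftPoint (zs q) : fstPoint (shiftPoint zs q) = sndPoint zs := by
  simp [fstPoint, sndPoint, shiftPoint, map_fst_shift]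

theorem sndPoint_shiftPoint (zs q) : sndPoint (shiftPoint zs q) = q := by
  simp [sndPoint, shiftPoint, map_snd_shift, numeral_bits]

/-- The items are printed after the shift, when the stacks hold the previous point and `q`. The
factor 1056 is `2 * 8 + 40 * 26`: reading two coordinates and printing at most 40 items. -/
theorem runs_readPoint (w φ O) (zs : Bool → List (Bool × Bool)) (q : ℕ × ℕ) {M : ℕ}
    (hM : ∀ b, (zs b).length ≤ M) (hq : q.1.bits.length ≤ M ∧ q.2.bits.length ≤ M) :
    readPoint.Runs (conf (encodeGridPoint q ++ w) none 0 φ O [] [] (pairs zs))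
      (conf w none 0 φ.next
        (encodePoints ((((items φ).map (itemPoint (sndPoint zs) q)).reverse).map toRat) ++ O)
          [] [] (pairs (shiftPoint zs q)))
      (1056 * M + 9100) := by
  have hM' : ∀ b, (shiftPoint zs q b).length ≤ M := by
    rintro (_ | _)
    · simpa [shiftPoint, length_shift] using ⟨hM false, hq.1⟩
    · simpa [shiftPoint, length_shift] using ⟨hM true, hq.2⟩
  have h₁ := runs_readCoord false .comma (encodeNatural q.2 ++ .semicolon :: w) none 0 φ O []
    rfl (zs false) q.1.bits (pairs zs) rfl
  have h₂ := runs_readCoord true .semicolon w none 0 φ O []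
    rfl (zs true) q.2.bits
    (Function.update (pairs zs) false ((shift (zs false) q.1.bits).map pairLetter))
    (by simp [pairs])
  have hw : q.1.bits.map Letter.bit ++ .comma :: (encodeNatural q.2 ++ .semicolon :: w) =
      encodeGridPoint q ++ w := by simp [encodeGridPoint, encodeNatural]
  have hZ : Function.update
      (Function.update (pairs zs) false ((shift (zs false) q.1.bits).map pairLetter)) true
      ((shift (zs true) q.2.bits).map pairLetter) = pairs (shiftPoint zs q) := by
    funext b
    cases b <;> simp [pairs, shiftPoint]
  rw [hw] at h₁
  rw [hZ] at h₂
  have h₃ := fun φ' => runs_emitItems w φ O (shiftPoint zs q) hM' (items φ') (items_bound φ')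
  rw [fstPoint_shiftPoint, sndPoint_shiftPoint] at h₃
  have h₄ := runs_load_phase (fun r => r.phase.next) w none 0 φ
    (encodePoints ((((items φ).map (itemPoint (sndPoint zs) q)).reverse).map toRat) ++ O) [] []
    (pairs (shiftPoint zs q))
  have hlen := fun φ' => Nat.mul_le_mul_right (26 * M + 226) (length_items_le φ')
  have h₅ : (ite (fun r : Reg => r.phase = .vertex) (seqs ((items .vertex).map emitItem)) <|
      .ite (fun r => r.phase = .routeStart) (seqs ((items .routeStart).map emitItem)) <|
      .ite (fun r => r.phase = .routeFirst) (seqs ((items .routeFirst).map emitItem))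
        (seqs ((items .routeRest).map emitItem)) : Prog).Runs
      (conf w none 0 φ O [] [] (pairs (shiftPoint zs q)))
      (conf w none 0 φ
        (encodePoints ((((items φ).map (itemPoint (sndPoint zs) q)).reverse).map toRat) ++ O)
          [] [] (pairs (shiftPoint zs q))) (40 * (26 * M + 226) + 4) := by
    have := hlen φ
    cases φ
    · exact (Runs.ite_true (by simp [conf]) (h₃ _)).mono (by omega)
    · exact (Runs.ite_false (by simp [conf]) (Runs.ite_true (by simp [conf]) (h₃ _))).mono
        (by omega)
    · exact (Runs.ite_false (by simp [conf]) (Runs.ite_false (by simp [conf])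
        (Runs.ite_true (by simp [conf]) (h₃ _)))).mono (by omega)
    · exact (Runs.ite_false (by simp [conf]) (Runs.ite_false (by simp [conf])
        (Runs.ite_false (by simp [conf]) (h₃ _)))).mono (by omega)
  have e₁ := hM' false
  have e₂ := hM' true
  simp only [shiftPoint] at e₁ e₂
  exact (h₁.seq (h₂.seq (h₅.seq h₄))).mono (by omega)

/-- The input is a sequence of tokens. -/
inductive Token where
  | vertex
  | edge
  | point (p : ℕ × ℕ)

def encodeToken : Token → List Letter
  | .vertex => [.vertex]
  | .edge => [.edge]
  | .point p => encodeGridPoint p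

/-- The points printed for a sequence of tokens. -/
def printed : Phase → ℕ × ℕ → List Token → List (ℕ × ℕ)
  | _, _, [] => []
  | _, p, .vertex :: l => printed .vertex p l
  | _, p, .edge :: l => printed .routeStart p l
  | φ, p, .point q :: l => printed φ.next q l ++ ((items φ).map (itemPoint p q)).reverse

/-- Read the input token by token. -/
def mainLoop : Prog :=
  .loop (fun r => r.inp.isSome) <|
    .ite (fun r => r.inp = some .vertex)
      (.seq (.load fun r => { r with phase := .vertex }) popInp) <|
    .ite (fun r => r.inp = some .edge)
      (.seq (.load fun r => { r with phase := .routeStart }) popInp) readPoint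

/-- One letter of lookahead identifies the token. The comma occurs because 0 has no binary digits.
-/
theorem head_encodeGridPoint (q : ℕ × ℕ) (w : List Letter) :
    ∃ a, (encodeGridPoint q ++ w).head? = some a ∧ a ≠ .vertex ∧ a ≠ .edge := by
  rcases h : q.1.bits with _ | ⟨b, l⟩
  · exact ⟨.comma, by simp [encodeGridPoint, encodeNatural, h]⟩
  · exact ⟨.bit b, by simp [encodeGridPoint, encodeNatural, h]⟩

/-- The final phase and coordinate stacks are irrelevant, except that the bound on their length pays
for erasing them. -/
theorem runs_mainLoop {M : ℕ} (l : List Token)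
    (hl : ∀ q, Token.point q ∈ l → q.1.bits.length ≤ M ∧ q.2.bits.length ≤ M) (φ O)
    (zs : Bool → List (Bool × Bool)) (hM : ∀ b, (zs b).length ≤ M) :
    ∃ φ' zs', (∀ b, (zs' b).length ≤ M) ∧ mainLoop.Runs
      (conf (l.flatMap encodeToken) none 0 φ O [] [] (pairs zs))
      (conf [] none 0 φ' (encodePoints ((printed φ (sndPoint zs) l).map toRat) ++ O) [] []
        (pairs zs'))
      (l.length * (1056 * M + 9110) + 1) := by
  induction l generalizing φ O zs with
  | nil =>
    refine ⟨φ, zs, hM, ?_⟩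
    exact (runs_loop_done (by simp [conf])).mono (by simp)
  | cons a l ih =>
    have hl' : ∀ q, Token.point q ∈ l → q.1.bits.length ≤ M ∧ q.2.bits.length ≤ M :=
      fun q hq => hl q (by simp [hq])
    cases a with
    | vertex =>
      obtain ⟨φ', zs', hM', h⟩ := ih hl' .vertex O zs hM
      refine ⟨φ', zs', hM', ?_⟩
      refine (Runs.loop_step (by simp [conf])
        (Runs.ite_true (by simp [conf])
        ((runs_load_phase (fun _ => .vertex) _ _ _ _ _ _ _ _).seq
          (runs_popInp (.vertex :: l.flatMap encodeToken) _ _ _ _ _ _ _)))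
        h).mono ?_
      rw [List.length_cons, add_one_mul l.length]
      omega
    | edge =>
      obtain ⟨φ', zs', hM', h⟩ := ih hl' .routeStart O zs hM
      refine ⟨φ', zs', hM', ?_⟩
      refine (Runs.loop_step (by simp [conf])
        (Runs.ite_false (by simp [conf])
        (Runs.ite_true (by simp [conf])
        ((runs_load_phase (fun _ => .routeStart) _ _ _ _ _ _ _ _).seq
          (runs_popInp (.edge :: l.flatMap encodeToken) _ _ _ _ _ _ _)))) h).mono ?_
      rw [List.length_cons, add_one_mul l.length]
      omega
    | point q =>
      have hM₁ : ∀ b, (shiftPoint zs q b).length ≤ M := by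
        have := hl q (by simp)
        rintro (_ | _)
        · simpa [shiftPoint, length_shift] using ⟨hM false, this.1⟩
        · simpa [shiftPoint, length_shift] using ⟨hM true, this.2⟩
      obtain ⟨φ', zs', hM', h⟩ := ih hl' φ.next
        (encodePoints ((((items φ).map (itemPoint (sndPoint zs) q)).reverse).map toRat) ++ O)
        (shiftPoint zs q) hM₁
      refine ⟨φ', zs', hM', ?_⟩
      rw [← List.append_assoc, ← encodePoints_append, ← List.map_append, sndPoint_shiftPoint] at h
      obtain ⟨a, ha, ha₁, ha₂⟩ := head_encodeGridPoint q (l.flatMap encodeToken)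
      have hr := runs_readPoint (l.flatMap encodeToken) φ O zs q hM (hl q (by simp))
      refine (Runs.loop_step ?_ (Runs.ite_false ?_ (Runs.ite_false ?_ hr)) h).mono ?_
      · simp [conf, ha]
      · simp [conf, ha, ha₁]
      · simp [conf, ha, ha₂]
      · rw [List.length_cons, add_one_mul l.length]
        omega

/-- The register at the beginning and at the end. -/
def initReg : Reg := ⟨none, none, 0, .vertex⟩

/-- The clean-up brings the machine into the shape required of a halting configuration. -/
def mainProg : Prog :=
  .seq popInp <| .seq mainLoop <| .seq (clear false) <| .seq (clear true) (.load fun _ => initReg)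

theorem update_const_eq_mem_inp (w : List Letter) :
    Function.update (fun _ => []) Stack.inp w = mem w [] [] [] fun _ => [] := by
  funext k; cases k <;> simp [mem]

theorem update_const_eq_mem_out (w : List Letter) :
    Function.update (fun _ => []) Stack.out w = mem [] w [] [] fun _ => [] := by
  funext k; cases k <;> simp [mem]

theorem runs_mainProg {M : ℕ} (l : List Token)
    (hl : ∀ q, Token.point q ∈ l → q.1.bits.length ≤ M ∧ q.2.bits.length ≤ M) :
    mainProg.Runs (initReg, Function.update (fun _ => []) Stack.inp (l.flatMap encodeToken))
      (initReg, Function.update (fun _ => []) Stack.out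
        (encodePoints ((printed .vertex (0, 0) l).map toRat)))
      (l.length * (1056 * M + 9110) + 4 * M + 7) := by
  obtain ⟨φ, zs, hM, h⟩ := runs_mainLoop l hl .vertex [] (fun _ => []) (by simp)
  have h₁ : popInp.Runs (initReg, mem (l.flatMap encodeToken) [] [] [] fun _ => [])
      (conf (l.flatMap encodeToken) none 0 .vertex [] [] [] (pairs fun _ => [])) 1 := by
    have := runs_pop (K := Stack) .inp (fun (r : Reg) a => { r with inp := a })
      (initReg, mem (l.flatMap encodeToken) [] [] [] fun _ => [])
    rw [update_inp] at this
    exact this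
  have h₂ := runs_clear false [] none 0 φ
    (encodePoints ((printed .vertex (0, 0) l).map toRat)) [] [] (pairs zs)
  have h₃ := runs_clear true [] none 0 φ
    (encodePoints ((printed .vertex (0, 0) l).map toRat)) [] []
    (Function.update (pairs zs) false [])
  have hZ : Function.update (Function.update (pairs zs) false []) true [] = fun _ => [] := by
    funext b
    cases b <;> simp
  rw [hZ] at h₃
  have h₄ := runs_load (fun _ => initReg) (conf [] none 0 φ
    (encodePoints ((printed .vertex (0, 0) l).map toRat)) [] [] fun _ => [])
  have hs : sndPoint (fun _ => []) = (0, 0) := rfl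
  rw [List.append_nil, hs] at h
  rw [update_const_eq_mem_inp, update_const_eq_mem_out]
  refine (h₁.seq (h.seq (h₂.seq (h₃.seq h₄)))).mono ?_
  have e₁ := hM false
  have e₂ := hM true
  simp [pairs] at e₁ e₂ ⊢
  omega

/-- The machine of the reduction. -/
def machine : Turing.TM2ComputableAux Letter Letter where
  tm := mainProg.toFinTM2 .inp .out initReg
  inputAlphabet := Equiv.refl Letter
  outputAlphabet := Equiv.refl Letter

theorem one_le_length_encodeToken (a : Token) : 1 ≤ (encodeToken a).length := by
  cases a <;> simp [encodeToken, encodeGridPoint]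
  omega

/-- Every token has at least one letter, and a coordinate has no more digits than the input has
letters. So `N` bounds both the number of tokens and the length of the numbers. -/
theorem haltsWithOutputIn_machine (l : List Token) {N : ℕ}
    (hN : (l.flatMap encodeToken).length ≤ N) :
    HaltsWithOutputIn machine (l.flatMap encodeToken)
      (encodePoints ((printed .vertex (0, 0) l).map toRat)) (10000 * (N + 1) ^ 2) := by
  have hlen : l.length ≤ N := by
    refine le_trans ?_ hN
    rw [List.length_flatMap]
    simpa using List.length_le_sum_of_one_le (l.map fun a => (encodeToken a).length)
      (by simpa using fun a _ => one_le_length_encodeToken a)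
  have hl : ∀ q, Token.point q ∈ l → q.1.bits.length ≤ N ∧ q.2.bits.length ≤ N := by
    intro q hq
    have h : (encodeGridPoint q).length ≤ N :=
      (List.sublist_flatten_of_mem (List.mem_map_of_mem (f := encodeToken) hq)).length_le.trans
        (by simpa [List.flatMap_def] using hN)
    simp [encodeGridPoint, encodeNatural] at h
    omega
  have h := outputsInTime mainProg .inp .out initReg ((runs_mainProg l hl).mono
    (t' := 10000 * (N + 1) ^ 2) (by nlinarith))
  have e : ∀ w : List Letter, w.map machine.inputAlphabet.symm = w := List.map_id
  have e' : ∀ w : List Letter, w.map machine.outputAlphabet.symm = w := List.map_id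
  unfold HaltsWithOutputIn
  rw [e, e']
  exact h

end CoverReduction

namespace CoverReduction

/-! ### Covers of sets of grid points -/

/-- Equal or neighbouring grid points. -/
def Near (p q : ℕ × ℕ) : Prop :=
  (p.1 = q.1 ∧ (p.2 = q.2 ∨ p.2 + 1 = q.2 ∨ q.2 + 1 = p.2)) ∨
    (p.2 = q.2 ∧ (p.1 + 1 = q.1 ∨ q.1 + 1 = p.1))

instance (p q : ℕ × ℕ) : Decidable (Near p q) := by unfold Near; infer_instance

/-- Three disjoint subsets of `P` such that each point of `P` is near to each of them. -/
def IsTriple (P : Set (ℕ × ℕ)) (T : Fin 3 → Set (ℕ × ℕ)) : Prop :=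
  Pairwise (fun i j => Disjoint (T i) (T j)) ∧
    ∀ i, T i ⊆ P ∧ ∀ p ∈ P, ∃ q ∈ T i, Near p q

/-! ### From Euclidean distance to grid adjacency -/

noncomputable def toPlane (p : ℕ × ℕ) : EuclideanSpace ℝ (Fin 2) := !₂[(p.1 : ℝ), (p.2 : ℝ)]

theorem toPlane_injective : Function.Injective toPlane := by
  intro p q h
  have h₀ := congrArg (fun x : EuclideanSpace ℝ (Fin 2) => x 0) h
  have h₁ := congrArg (fun x : EuclideanSpace ℝ (Fin 2) => x 1) h
  simp [toPlane] at h₀ h₁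
  exact Prod.ext h₀ h₁

theorem dist_toPlane_sq (p q : ℕ × ℕ) :
    dist (toPlane p) (toPlane q) ^ 2 = ((p.1 : ℝ) - q.1) ^ 2 + ((p.2 : ℝ) - q.2) ^ 2 := by
  rw [EuclideanSpace.dist_eq, Real.sq_sqrt (by positivity)]
  simp [toPlane, Real.dist_eq]

theorem near_iff_sq (p q : ℕ × ℕ) :
    Near p q ↔ ((p.1 : ℤ) - q.1) ^ 2 + ((p.2 : ℤ) - q.2) ^ 2 < 2 := by
  constructor
  · rintro (⟨h, h' | h' | h'⟩ | ⟨h, h' | h'⟩)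
    · simp [h, h']
    · rw [h, ← h']; push_cast; ring_nf; norm_num
    · rw [h, ← h']; push_cast; ring_nf; norm_num
    · rw [h, ← h']; push_cast; ring_nf; norm_num
    · rw [h, ← h']; push_cast; ring_nf; norm_num
  · intro h
    have h₁ : |(p.1 : ℤ) - q.1| ≤ 1 := by
      rw [← sq_le_one_iff_abs_le_one]; nlinarith [sq_nonneg ((p.2 : ℤ) - q.2)]
    have h₂ : |(p.2 : ℤ) - q.2| ≤ 1 := by
      rw [← sq_le_one_iff_abs_le_one]; nlinarith [sq_nonneg ((p.1 : ℤ) - q.1)]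
    rw [abs_le] at h₁ h₂
    have e₁ : (p.1 : ℤ) - q.1 = -1 ∨ (p.1 : ℤ) - q.1 = 0 ∨ (p.1 : ℤ) - q.1 = 1 := by omega
    have e₂ : (p.2 : ℤ) - q.2 = -1 ∨ (p.2 : ℤ) - q.2 = 0 ∨ (p.2 : ℤ) - q.2 = 1 := by omega
    unfold Near
    rcases e₁ with e₁ | e₁ | e₁ <;> rcases e₂ with e₂ | e₂ | e₂ <;> rw [e₁, e₂] at h <;> omega

/-- The squared distance is an integer, so being less than 2 is the same as being at most 1. -/
theorem dist_toPlane_le_iff {r : ℝ} (hr : 1 ≤ r) (hr' : r < Real.sqrt 2) (p q : ℕ × ℕ) :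
    dist (toPlane p) (toPlane q) ≤ r ↔ Near p q := by
  have hsq : dist (toPlane p) (toPlane q) ^ 2 =
      (((((p.1 : ℤ) - q.1) ^ 2 + ((p.2 : ℤ) - q.2) ^ 2 : ℤ)) : ℝ) := by
    rw [dist_toPlane_sq]; push_cast; rfl
  have hd : 0 ≤ dist (toPlane p) (toPlane q) := dist_nonneg
  rw [near_iff_sq]
  constructor
  · intro h
    have h2 : dist (toPlane p) (toPlane q) ^ 2 < 2 := by
      have := Real.sq_sqrt (show (0 : ℝ) ≤ 2 by norm_num)
      nlinarith [Real.sqrt_nonneg 2]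
    rw [hsq] at h2
    exact_mod_cast h2
  · intro h
    have h2 : dist (toPlane p) (toPlane q) ^ 2 ≤ 1 := by
      have h1 : ((p.1 : ℤ) - q.1) ^ 2 + ((p.2 : ℤ) - q.2) ^ 2 ≤ 1 := Int.lt_add_one_iff.mp h
      rw [hsq]
      exact_mod_cast h1
    exact ((sq_le_one_iff₀ hd).mp h2).trans hr

theorem hasSolidarityCover_image_iff {r : ℝ} (hr : 1 ≤ r) (hr' : r < Real.sqrt 2)
    (P : Set (ℕ × ℕ)) :
    HasSolidarityCover (toPlane '' P) 3 r ↔ ∃ T, IsTriple P T := by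
  constructor
  · rintro ⟨T, hT, hc⟩
    refine ⟨fun i => toPlane ⁻¹' T i, fun i j hij => (hT hij).preimage _, fun i => ⟨?_, ?_⟩⟩
    · intro p hp
      obtain ⟨q, hq, hqp⟩ := (hc i).1 hp
      rwa [← toPlane_injective hqp]
    · intro p hp
      obtain ⟨t, ht, hd⟩ := (hc i).2 _ (Set.mem_image_of_mem _ hp)
      obtain ⟨q, -, rfl⟩ := (hc i).1 ht
      exact ⟨q, ht, (dist_toPlane_le_iff hr hr' p q).1 hd⟩
  · rintro ⟨T, hT, hc⟩
    refine ⟨fun i => toPlane '' T i,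
      fun i j hij => (Set.disjoint_image_iff toPlane_injective).2 (hT hij), fun i => ⟨?_, ?_⟩⟩
    · exact Set.image_mono (hc i).1
    · rintro _ ⟨p, hp, rfl⟩
      obtain ⟨q, hq, h⟩ := (hc i).2 p hp
      exact ⟨_, Set.mem_image_of_mem _ hq, (dist_toPlane_le_iff hr hr' p q).2 h⟩

/-! ### The gadgets -/

/-- The grid points `(a, b)` that are used, and which of the segments from `(a, b)` to `(a + 1, b)` and
to `(a, b + 1)` are drawn as plain wires and as special wires. -/
structure Layout where
  used : ℕ → ℕ → Prop
  hplain : ℕ → ℕ → Prop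
  hspecial : ℕ → ℕ → Prop
  vplain : ℕ → ℕ → Prop
  vspecial : ℕ → ℕ → Prop

/-- The boundary of a square of side `6`. -/
def OnRing (s t : ℕ) : Prop := s ≤ 6 ∧ t ≤ 6 ∧ (s = 0 ∨ s = 6 ∨ t = 0 ∨ t = 6)

/-- A plain wire between two squares. -/
def OnPlain (s t : ℕ) : Prop := 7 ≤ s ∧ s ≤ 11 ∧ t = 3

/-- A special wire between two squares. -/
def OnSpecial (s t : ℕ) : Prop :=
  7 ≤ s ∧ s ≤ 11 ∧ ((t = 3 ∧ s ≠ 9) ∨ (8 ≤ s ∧ s ≤ 10 ∧ (t = 2 ∨ t = 4)))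

/-- What is drawn in the cell of the grid point `(a, b)`. -/
def Layout.Cell (D : Layout) (a b s t : ℕ) : Prop :=
  (D.used a b ∧ OnRing s t) ∨ (D.hplain a b ∧ OnPlain s t) ∨ (D.hspecial a b ∧ OnSpecial s t) ∨
    (D.vplain a b ∧ OnPlain t s) ∨ (D.vspecial a b ∧ OnSpecial t s)

/-- The set of all points drawn. -/
def Layout.points (D : Layout) : Set (ℕ × ℕ) :=
  {p | ∃ a b s t, D.Cell a b s t ∧ p = (12 * a + s, 12 * b + t)}

/-- The mirror image of a layout. -/
def Layout.transpose (D : Layout) : Layout where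
  used a b := D.used b a
  hplain a b := D.vplain b a
  hspecial a b := D.vspecial b a
  vplain a b := D.hplain b a
  vspecial a b := D.hspecial b a

theorem Layout.cell_transpose (D : Layout) (a b s t : ℕ) :
    D.transpose.Cell a b s t ↔ D.Cell b a t s := by
  have : OnRing s t ↔ OnRing t s := by unfold OnRing; omega
  unfold Layout.Cell Layout.transpose
  simp only [this]
  tauto

theorem Layout.swap_mem_points (D : Layout) (p : ℕ × ℕ) :
    p.swap ∈ D.transpose.points ↔ p ∈ D.points := by
  constructor
  · rintro ⟨a, b, s, t, h, hp⟩
    exact ⟨b, a, t, s, (D.cell_transpose a b s t).1 h, by rw [← Prod.swap_swap p, hp]; rfl⟩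
  · rintro ⟨a, b, s, t, h, rfl⟩
    exact ⟨b, a, t, s, (D.cell_transpose b a t s).2 h, rfl⟩

theorem Near.swap {p q : ℕ × ℕ} (h : Near p q) : Near p.swap q.swap := by
  unfold Near at *
  simp only [Prod.fst_swap, Prod.snd_swap]
  omega

/-- This reduces horizontal sides and vertical wires to vertical sides and horizontal wires. -/
theorem IsTriple.transpose {D : Layout} {T : Fin 3 → Set (ℕ × ℕ)} (h : IsTriple D.points T) :
    IsTriple D.transpose.points fun i => Prod.swap ⁻¹' T i := by
  refine ⟨fun i j hij => (h.1 hij).preimage _, fun i => ⟨fun p hp => ?_, fun p hp => ?_⟩⟩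
  · have := (D.swap_mem_points p.swap).2 ((h.2 i).1 hp)
    simpa using this
  · rw [← Prod.swap_swap p, D.swap_mem_points] at hp
    obtain ⟨q, hq, hn⟩ := (h.2 i).2 _ hp
    exact ⟨q.swap, by simpa using hq, by simpa using hn.swap⟩

/-! #### From covers to colourings -/

open Classical in
/-- The number of the set that contains a given point. -/
noncomputable def colour (T : Fin 3 → Set (ℕ × ℕ)) (p : ℕ × ℕ) : Fin 3 :=
  if h : ∃ i, p ∈ T i then h.choose else 0

theorem colour_eq {P : Set (ℕ × ℕ)} {T : Fin 3 → Set (ℕ × ℕ)} (hT : IsTriple P T) {p : ℕ × ℕ}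
    {i : Fin 3} (h : p ∈ T i) : colour T p = i := by
  have h' : ∃ i, p ∈ T i := ⟨i, h⟩
  rw [colour, dif_pos h']
  by_contra hne
  exact Set.disjoint_left.1 (hT.1 hne) h'.choose_spec h

theorem colour_transpose (T : Fin 3 → Set (ℕ × ℕ)) (p : ℕ × ℕ) :
    colour (fun i => Prod.swap ⁻¹' T i) p = colour T p.swap := rfl

/-- All three sets meet the closed neighbourhood of `p`, so three colours occur on at most three
points. The default value of `colour` is harmless: each colour is already witnessed by a member of
its set. -/
theorem colour_ne {P : Set (ℕ × ℕ)} {T : Fin 3 → Set (ℕ × ℕ)} (hT : IsTriple P T)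
    {p q q' : ℕ × ℕ} (hp : p ∈ P) (h : ∀ z ∈ P, Near p z → z = p ∨ z = q ∨ z = q') :
    colour T p ≠ colour T q ∧ colour T p ≠ colour T q' ∧ colour T q ≠ colour T q' := by
  have key : ∀ i, colour T p = i ∨ colour T q = i ∨ colour T q' = i := by
    intro i
    obtain ⟨z, hz, hn⟩ := (hT.2 i).2 p hp
    have := colour_eq hT hz
    rcases h z ((hT.2 i).1 hz) hn with rfl | rfl | rfl <;> simp [this]
  revert key
  generalize colour T p = u
  generalize colour T q = v
  generalize colour T q' = w
  revert u v w
  decide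

/-- Both `z₀` and `z₃` have the one colour that differs from those of `z₁` and `z₂`. -/
theorem colour_eq_of_path {P : Set (ℕ × ℕ)} {T : Fin 3 → Set (ℕ × ℕ)} (hT : IsTriple P T)
    {z₀ z₁ z₂ z₃ : ℕ × ℕ} (h₁ : z₁ ∈ P) (h₂ : z₂ ∈ P)
    (h₁' : ∀ z ∈ P, Near z₁ z → z = z₁ ∨ z = z₀ ∨ z = z₂)
    (h₂' : ∀ z ∈ P, Near z₂ z → z = z₂ ∨ z = z₁ ∨ z = z₃) :
    colour T z₀ = colour T z₃ := by
  have e₁ := colour_ne hT h₁ h₁'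
  have e₂ := colour_ne hT h₂ h₂'
  omega

/-- Two neighbours of the same colour count as one, so the argument for two neighbours applies. -/
theorem colour_ne_of_eq {P : Set (ℕ × ℕ)} {T : Fin 3 → Set (ℕ × ℕ)} (hT : IsTriple P T)
    {p q q' q'' : ℕ × ℕ} (hp : p ∈ P)
    (h : ∀ z ∈ P, Near p z → z = p ∨ z = q ∨ z = q' ∨ z = q'') (hq : colour T q' = colour T q'') :
    colour T p ≠ colour T q ∧ colour T p ≠ colour T q' ∧ colour T q ≠ colour T q' := by
  have key : ∀ i, colour T p = i ∨ colour T q = i ∨ colour T q' = i := by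
    intro i
    obtain ⟨z, hz, hn⟩ := (hT.2 i).2 p hp
    have := colour_eq hT hz
    rcases h z ((hT.2 i).1 hz) hn with rfl | rfl | rfl | rfl <;> simp_all
  revert key
  generalize colour T p = u
  generalize colour T q = v
  generalize colour T q' = w
  revert u v w
  decide

namespace Layout

variable {D : Layout} {T : Fin 3 → Set (ℕ × ℕ)}

/-- The excluded values 0, 3, 6 of `t` are the corners, where the ring turns, and the midpoint,
where a wire may be attached. -/
theorem near_side {a b s t t₀ t₁ : ℕ} (hs : s = 0 ∨ s = 6)
    (ht : t = 1 ∨ t = 2 ∨ t = 4 ∨ t = 5) (h₀ : t₀ + 1 = t) (h₁ : t + 1 = t₁) :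
    ∀ z ∈ D.points, Near (12 * a + s, 12 * b + t) z → z = (12 * a + s, 12 * b + t) ∨
      z = (12 * a + s, 12 * b + t₀) ∨ z = (12 * a + s, 12 * b + t₁) := by
  rintro _ ⟨a', b', s', t', h, rfl⟩ hn
  unfold Near at hn
  simp only [Prod.mk.injEq]
  unfold Cell OnRing OnPlain OnSpecial at h
  rcases h with ⟨-, h⟩ | ⟨-, h⟩ | ⟨-, h⟩ | ⟨-, h⟩ | ⟨-, h⟩ <;> omega

theorem ring_mem {a b s t : ℕ} (h : D.used a b) (hst : OnRing s t) :
    (12 * a + s, 12 * b + t) ∈ D.points :=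
  ⟨a, b, s, t, Or.inl ⟨h, hst⟩, rfl⟩

theorem colour_side (hT : IsTriple D.points T) {a b s : ℕ} (h : D.used a b)
    (hs : s = 0 ∨ s = 6) :
    colour T (12 * a + s, 12 * b + 0) = colour T (12 * a + s, 12 * b + 3) ∧
      colour T (12 * a + s, 12 * b + 3) = colour T (12 * a + s, 12 * b + 6) := by
  have hm : ∀ t ≤ 6, (12 * a + s, 12 * b + t) ∈ D.points :=
    fun t ht => ring_mem h (by unfold OnRing; omega)
  exact ⟨colour_eq_of_path hT (hm 1 (by simp)) (hm 2 (by simp))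
      (near_side hs (by simp) rfl rfl) (near_side hs (by simp) rfl rfl),
    colour_eq_of_path hT (hm 4 (by simp)) (hm 5 (by simp))
      (near_side hs (by simp) rfl rfl) (near_side hs (by simp) rfl rfl)⟩

/-- All squares have a well-defined colour. -/
theorem colour_ring (hT : IsTriple D.points T) {a b : ℕ} (h : D.used a b) :
    colour T (12 * a + 6, 12 * b + 3) = colour T (12 * a + 0, 12 * b + 3) ∧
      colour T (12 * a + 3, 12 * b + 6) = colour T (12 * a + 0, 12 * b + 3) ∧
      colour T (12 * a + 3, 12 * b + 0) = colour T (12 * a + 0, 12 * b + 3) := by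
  obtain ⟨h₁, h₂⟩ := colour_side hT h (Or.inl rfl)
  obtain ⟨h₃, h₄⟩ := colour_side hT h (Or.inr rfl)
  -- The horizontal sides are vertical sides of the mirror image; the shared corners link all four
  -- midpoints.
  have h' : D.transpose.used b a := h
  obtain ⟨h₅, h₆⟩ := colour_side hT.transpose h' (Or.inl rfl)
  obtain ⟨h₇, h₈⟩ := colour_side hT.transpose h' (Or.inr rfl)
  simp only [colour_transpose, Prod.swap_prod_mk] at h₅ h₆ h₇ h₈
  omega

/-- Only a special wire drawn on the same segment could contribute further neighbours. -/
theorem near_plain {a b s s₀ s₁ : ℕ} (h : ¬ D.hspecial a b) (hs : 7 ≤ s ∧ s ≤ 11)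
    (h₀ : s₀ + 1 = s) (h₁ : s + 1 = s₁) :
    ∀ z ∈ D.points, Near (12 * a + s, 12 * b + 3) z → z = (12 * a + s, 12 * b + 3) ∨
      z = (12 * a + s₀, 12 * b + 3) ∨ z = (12 * a + s₁, 12 * b + 3) := by
  rintro _ ⟨a', b', s', t', h', rfl⟩ hn
  unfold Near at hn
  simp only [Prod.mk.injEq]
  unfold Cell OnRing OnPlain OnSpecial at h'
  rcases h' with ⟨-, h'⟩ | ⟨-, h'⟩ | ⟨hd, h'⟩ | ⟨-, h'⟩ | ⟨-, h'⟩
  · omega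
  · omega
  · by_cases e : a' = a ∧ b' = b
    · obtain ⟨rfl, rfl⟩ := e
      exact absurd hd h
    · omega
  · omega
  · omega

/-- The ends are six steps apart, which is two periods. -/
theorem plain_wire (hT : IsTriple D.points T) {a b : ℕ} (h : D.hplain a b)
    (h' : ¬ D.hspecial a b) :
    colour T (12 * a + 6, 12 * b + 3) = colour T (12 * a + 12, 12 * b + 3) := by
  have hm : ∀ s, 7 ≤ s ∧ s ≤ 11 → (12 * a + s, 12 * b + 3) ∈ D.points :=
    fun s hs => ⟨a, b, s, 3, Or.inr (Or.inl ⟨h, hs.1, hs.2, rfl⟩), rfl⟩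
  exact (colour_eq_of_path hT (hm 7 (by simp)) (hm 8 (by simp))
      (near_plain h' (by simp) rfl rfl) (near_plain h' (by simp) rfl rfl)).trans
    (colour_eq_of_path hT (hm 10 (by simp)) (hm 11 (by simp))
      (near_plain h' (by simp) rfl rfl) (near_plain h' (by simp) rfl rfl))

theorem near_special {a b s t : ℕ} (h : ¬ D.hplain a b) (hst : OnSpecial s t) :
    ∀ z ∈ D.points, Near (12 * a + s, 12 * b + t) z → ∃ s' t', z = (12 * a + s', 12 * b + t') ∧
      Near (s, t) (s', t') ∧ (OnSpecial s' t' ∨ (s' = 6 ∧ t' = 3) ∨ (s' = 12 ∧ t' = 3)) := by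
  rintro _ ⟨a', b', s', t', h', rfl⟩ hn
  unfold Near OnSpecial at *
  simp only at hn ⊢
  unfold Cell OnRing OnPlain OnSpecial at h'
  -- The truncated subtractions are exact: a special wire stays away from the left and lower borders
  -- of its cell, so its neighbours have coordinates at least `12 * a` and `12 * b`.
  refine ⟨12 * a' + s' - 12 * a, 12 * b' + t' - 12 * b, ?_, ?_, ?_⟩
  · simp only [Prod.mk.injEq]
    omega
  · omega
  rcases h' with ⟨-, h'⟩ | ⟨hd, h'⟩ | ⟨-, h'⟩ | ⟨-, h'⟩ | ⟨-, h'⟩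
  · omega
  · by_cases e : a' = a ∧ b' = b
    · obtain ⟨rfl, rfl⟩ := e
      exact absurd hd h
    · omega
  · omega
  · omega
  · omega

/-- Let `u`, `x`, `y` be the colours at 6, 7, 8 on the axis; they are distinct. Following either
half of the 8-cycle, (10, 4) and (10, 2) repeat `y`, while (10, 3) repeats the colour of (8, 4) and
of (8, 2). So these two agree, and the neighbourhood of (8, 3) makes their colour `u`. Then (10, 3)
has colour `u`, its neighbourhood gives (11, 3) the colour `x`, and the end at 12 gets `y ≠ u`. -/
theorem special_wire (hT : IsTriple D.points T) {a b : ℕ} (h : D.hspecial a b)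
    (h' : ¬ D.hplain a b) :
    colour T (12 * a + 6, 12 * b + 3) ≠ colour T (12 * a + 12, 12 * b + 3) := by
  have hm : ∀ s t, OnSpecial s t → (12 * a + s, 12 * b + t) ∈ D.points :=
    fun s t hst => ⟨a, b, s, t, Or.inr (Or.inr (Or.inl ⟨h, hst⟩)), rfl⟩
  have hn : ∀ s t s₁ t₁ s₂ t₂, OnSpecial s t →
      (∀ s' t', Near (s, t) (s', t') →
        OnSpecial s' t' ∨ (s' = 6 ∧ t' = 3) ∨ (s' = 12 ∧ t' = 3) →
        (s' = s ∧ t' = t) ∨ (s' = s₁ ∧ t' = t₁) ∨ (s' = s₂ ∧ t' = t₂)) →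
      colour T (12 * a + s, 12 * b + t) ≠ colour T (12 * a + s₁, 12 * b + t₁) ∧
      colour T (12 * a + s, 12 * b + t) ≠ colour T (12 * a + s₂, 12 * b + t₂) ∧
      colour T (12 * a + s₁, 12 * b + t₁) ≠ colour T (12 * a + s₂, 12 * b + t₂) := by
    intro s t s₁ t₁ s₂ t₂ hst hq
    refine colour_ne hT (hm s t hst) fun z hz hzn => ?_
    obtain ⟨s', t', rfl, hzn', ho⟩ := near_special h' hst z hz hzn
    simpa using hq s' t' hzn' ho
  have hn' : ∀ s t s₁ t₁ s₂ t₂ s₃ t₃, OnSpecial s t →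
      (∀ s' t', Near (s, t) (s', t') →
        OnSpecial s' t' ∨ (s' = 6 ∧ t' = 3) ∨ (s' = 12 ∧ t' = 3) →
        (s' = s ∧ t' = t) ∨ (s' = s₁ ∧ t' = t₁) ∨ (s' = s₂ ∧ t' = t₂) ∨ (s' = s₃ ∧ t' = t₃)) →
      colour T (12 * a + s₂, 12 * b + t₂) = colour T (12 * a + s₃, 12 * b + t₃) →
      colour T (12 * a + s, 12 * b + t) ≠ colour T (12 * a + s₁, 12 * b + t₁) ∧
      colour T (12 * a + s, 12 * b + t) ≠ colour T (12 * a + s₂, 12 * b + t₂) ∧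
      colour T (12 * a + s₁, 12 * b + t₁) ≠ colour T (12 * a + s₂, 12 * b + t₂) := by
    intro s t s₁ t₁ s₂ t₂ s₃ t₃ hst hq hc
    refine colour_ne_of_eq hT (hm s t hst) (fun z hz hzn => ?_) hc
    obtain ⟨s', t', rfl, hzn', ho⟩ := near_special h' hst z hz hzn
    simpa using hq s' t' hzn' ho
  unfold Near OnSpecial at hn hn'
  have e₁ := hn 7 3 6 3 8 3 (by omega) (by omega)
  have e₂ := hn 8 4 8 3 9 4 (by omega) (by omega)
  have e₃ := hn 9 4 8 4 10 4 (by omega) (by omega)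
  have e₄ := hn 10 4 9 4 10 3 (by omega) (by omega)
  have f₂ := hn 8 2 8 3 9 2 (by omega) (by omega)
  have f₃ := hn 9 2 8 2 10 2 (by omega) (by omega)
  have f₄ := hn 10 2 9 2 10 3 (by omega) (by omega)
  have e₅ := hn 11 3 10 3 12 3 (by omega) (by omega)
  -- At the two branch points of the cycle, the neighbours above and below have equal colours by the
  -- preceding facts.
  have e₆ := hn' 8 3 7 3 8 4 8 2 (by omega) (by omega) (by omega)
  have e₇ := hn' 10 3 11 3 10 4 10 2 (by omega) (by omega) (by omega)
  omega

/-- A triple of covers yields a colouring of the grid points. -/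
theorem exists_colouring_of_isTriple (hh : ∀ a b, D.hplain a b → ¬ D.hspecial a b)
    (hv : ∀ a b, D.vplain a b → ¬ D.vspecial a b)
    (hhu : ∀ a b, D.hplain a b ∨ D.hspecial a b → D.used a b ∧ D.used (a + 1) b)
    (hvu : ∀ a b, D.vplain a b ∨ D.vspecial a b → D.used a b ∧ D.used a (b + 1))
    (hT : IsTriple D.points T) :
    ∃ f : ℕ → ℕ → Fin 3, (∀ a b, D.hplain a b → f a b = f (a + 1) b) ∧
      (∀ a b, D.hspecial a b → f a b ≠ f (a + 1) b) ∧
      (∀ a b, D.vplain a b → f a b = f a (b + 1)) ∧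
      (∀ a b, D.vspecial a b → f a b ≠ f a (b + 1)) := by
  -- The colour of a square is read at the midpoint of its left side, which is also the right end,
  -- `12 * a + 12`, of a wire from the square to its left.
  refine ⟨fun a b => colour T (12 * a + 0, 12 * b + 3), ?_, ?_, ?_, ?_⟩
  · intro a b h
    have h₁ := plain_wire hT h (hh a b h)
    have h₂ := (colour_ring hT (hhu a b (Or.inl h)).1).1
    simp only [Nat.mul_add, Nat.mul_one, Nat.add_zero] at *
    omega
  · intro a b h
    have h₁ := special_wire hT h fun hp => hh a b hp h
    have h₂ := (colour_ring hT (hhu a b (Or.inr h)).1).1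
    simp only [Nat.mul_add, Nat.mul_one, Nat.add_zero] at *
    omega
  · intro a b h
    have h₁ := plain_wire (D := D.transpose) hT.transpose (a := b) (b := a) h (hv a b h)
    have h₂ := (colour_ring hT (hvu a b (Or.inl h)).1).2.1
    have h₃ := (colour_ring hT (hvu a b (Or.inl h)).2).2.2
    simp only [Nat.mul_add, Nat.mul_one, Nat.add_zero, colour_transpose, Prod.swap_prod_mk] at *
    omega
  · intro a b h
    have h₁ := special_wire (D := D.transpose) hT.transpose (a := b) (b := a) h
      fun hp => hv a b hp h
    have h₂ := (colour_ring hT (hvu a b (Or.inr h)).1).2.1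
    have h₃ := (colour_ring hT (hvu a b (Or.inr h)).2).2.2
    simp only [Nat.mul_add, Nat.mul_one, Nat.add_zero, colour_transpose, Prod.swap_prod_mk] at *
    omega

end Layout

end CoverReduction

namespace CoverReduction

namespace Layout

/-! #### From colourings to covers -/

instance (s t : ℕ) : Decidable (OnRing s t) := by unfold OnRing; infer_instance
instance (s t : ℕ) : Decidable (OnPlain s t) := by unfold OnPlain; infer_instance
instance (s t : ℕ) : Decidable (OnSpecial s t) := by unfold OnSpecial; infer_instance

/-- The ends of a wire between two squares. -/
def OnEnd (s t : ℕ) : Prop := (s = 6 ∨ s = 12) ∧ t = 3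

instance (s t : ℕ) : Decidable (OnEnd s t) := by unfold OnEnd; infer_instance

/-- The colours of a square of colour `u`. -/
def ringColour (u : Fin 3) (s t : ℕ) : Fin 3 :=
  if s = 6 then u + Fin.ofNat 3 t
  else if t = 6 then u + Fin.ofNat 3 (2 * s)
  else if s = 0 then u + Fin.ofNat 3 (2 * t)
  else u + Fin.ofNat 3 s

/-- The colours of a plain wire between two squares of colour `u`. -/
def plainColour (u : Fin 3) (s : ℕ) : Fin 3 := u + Fin.ofNat 3 s

/-- The colours of a special wire between squares of colours `u` and `v`. -/
def specialColour (u v : Fin 3) (s t : ℕ) : Fin 3 :=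
  if s = 6 then u else if s = 12 then v
  else if s = 8 then (if t = 3 then v else u)
  else if s = 10 then (if t = 3 then u else v)
  else -u - v

/-- The four neighbours of a grid point, and the point itself. -/
def nearList (s t : ℕ) : List (ℕ × ℕ) := [(s, t), (s + 1, t), (s - 1, t), (s, t + 1), (s, t - 1)]

/-- The colour increases by one at each step around the ring, `2 * s` standing for `-s` modulo 3. It
closes up because the ring has 24 points. -/
theorem ringColour_near : ∀ s < 7, ∀ t < 7, OnRing s t → ∀ u i : Fin 3,
    ∃ q ∈ nearList s t, Near (s, t) q ∧ OnRing q.1 q.2 ∧ ringColour u q.1 q.2 = i := by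
  decide

theorem plainColour_near : ∀ s < 12, 7 ≤ s → ∀ u i : Fin 3,
    ∃ q ∈ nearList s 3, Near (s, 3) q ∧
      (OnPlain q.1 q.2 ∨ OnEnd q.1 q.2) ∧ plainColour u q.1 = i := by
  decide

-- For `u ≠ v` the third colour is `-u - v`, since the three elements of `Fin 3` sum to 0.
set_option synthInstance.maxSize 1000 in
set_option synthInstance.maxHeartbeats 200000 in
theorem specialColour_near : ∀ s < 12, ∀ t < 5, OnSpecial s t → ∀ u v i : Fin 3, u ≠ v →
    ∃ q ∈ nearList s t, Near (s, t) q ∧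
      (OnSpecial q.1 q.2 ∨ OnEnd q.1 q.2) ∧ specialColour u v q.1 q.2 = i := by
  decide

open Classical in
/-- The colours of all points, given the colours `f` of the squares. -/
noncomputable def cellColour (D : Layout) (f : ℕ → ℕ → Fin 3) (a b s t : ℕ) : Fin 3 :=
  if s ≤ 6 ∧ t ≤ 6 then ringColour (f a b) s t
  else if t ≤ 6 then
    if D.hspecial a b then specialColour (f a b) (f (a + 1) b) s t else plainColour (f a b) s
  else
    if D.vspecial a b then specialColour (f a b) (f a (b + 1)) t s else plainColour (f a b) t

/-- The colour classes of all points serve as the three sets. Covering is local, so it reduces to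
the finite checks for one ring and one wire, once the colours prescribed at the ends of a wire are
matched with those of the squares. -/
theorem exists_isTriple (D : Layout) (hh : ∀ a b, D.hplain a b → ¬ D.hspecial a b)
    (hv : ∀ a b, D.vplain a b → ¬ D.vspecial a b)
    (hhu : ∀ a b, D.hplain a b ∨ D.hspecial a b → D.used a b ∧ D.used (a + 1) b)
    (hvu : ∀ a b, D.vplain a b ∨ D.vspecial a b → D.used a b ∧ D.used a (b + 1))
    (f : ℕ → ℕ → Fin 3) (h₁ : ∀ a b, D.hplain a b → f a b = f (a + 1) b)
    (h₂ : ∀ a b, D.hspecial a b → f a b ≠ f (a + 1) b)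
    (h₃ : ∀ a b, D.vplain a b → f a b = f a (b + 1))
    (h₄ : ∀ a b, D.vspecial a b → f a b ≠ f a (b + 1)) :
    ∃ T, IsTriple D.points T := by
  let κ : ℕ × ℕ → Fin 3 := fun p => D.cellColour f (p.1 / 12) (p.2 / 12) (p.1 % 12) (p.2 % 12)
  have hκ : ∀ a b s t, s < 12 → t < 12 →
      κ (12 * a + s, 12 * b + t) = D.cellColour f a b s t := by
    intro a b s t hs ht
    have e₁ : (12 * a + s) / 12 = a := by omega
    have e₂ : (12 * a + s) % 12 = s := by omega
    have e₃ : (12 * b + t) / 12 = b := by omega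
    have e₄ : (12 * b + t) % 12 = t := by omega
    simp only [κ, e₁, e₂, e₃, e₄]
  have hring : ∀ a b s t, D.used a b → OnRing s t → (12 * a + s, 12 * b + t) ∈ D.points ∧
      κ (12 * a + s, 12 * b + t) = ringColour (f a b) s t := by
    intro a b s t h hst
    refine ⟨ring_mem h hst, ?_⟩
    have h' : s ≤ 6 ∧ t ≤ 6 := ⟨hst.1, hst.2.1⟩
    rw [hκ _ _ _ _ (by omega) (by omega), cellColour, if_pos h']
  have hmid : ∀ u : Fin 3, ringColour u 6 3 = u ∧ ringColour u 0 3 = u ∧ ringColour u 3 6 = u ∧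
      ringColour u 3 0 = u ∧ plainColour u 6 = u ∧ plainColour u 12 = u := by decide
  have hmid' : ∀ u v : Fin 3, specialColour u v 6 3 = u ∧ specialColour u v 12 3 = v := by decide
  refine ⟨fun i => {p | p ∈ D.points ∧ κ p = i}, fun i j hij => ?_, fun i => ⟨fun p hp => hp.1, ?_⟩⟩
  · exact Set.disjoint_left.2 fun p hp hp' => hij (hp.2.symm.trans hp'.2)
  rintro _ ⟨a, b, s, t, h, rfl⟩
  have hshift : ∀ s' t', Near (s, t) (s', t') →
      Near (12 * a + s, 12 * b + t) (12 * a + s', 12 * b + t') := by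
    intro s' t' h
    unfold Near at *
    simp only at *
    omega
  rcases h with ⟨h, hst⟩ | ⟨h, hst⟩ | ⟨h, hst⟩ | ⟨h, hst⟩ | ⟨h, hst⟩
  · obtain ⟨⟨s', t'⟩, -, hn, hq, hc⟩ := ringColour_near s (by unfold OnRing at hst; omega) t
      (by unfold OnRing at hst; omega) hst (f a b) i
    obtain ⟨hm, hk⟩ := hring a b s' t' h hq
    exact ⟨_, ⟨hm, hk.trans hc⟩, hshift _ _ hn⟩
  · obtain ⟨hs, hs', rfl⟩ := hst
    obtain ⟨⟨s', t'⟩, -, hn, hq, hc⟩ := plainColour_near s (by omega) hs (f a b) i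
    obtain ⟨hm, hk⟩ : (12 * a + s', 12 * b + t') ∈ D.points ∧
        κ (12 * a + s', 12 * b + t') = plainColour (f a b) s' := by
      rcases hq with hq | ⟨rfl | rfl, rfl⟩
      · refine ⟨⟨a, b, s', t', Or.inr (Or.inl ⟨h, hq⟩), rfl⟩, ?_⟩
        obtain ⟨hq, hq', rfl⟩ := hq
        rw [hκ _ _ _ _ (by omega) (by omega), cellColour, if_neg (by omega), if_pos (by omega),
          if_neg (hh a b h)]
      · simpa [hmid] using hring a b 6 3 (hhu a b (Or.inl h)).1 (by decide)
      -- The end at 12 belongs to the next cell, where it is the midpoint 0 of the left side.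
      · simpa [hmid, mul_add, h₁ a b h] using
          hring (a + 1) b 0 3 (hhu a b (Or.inl h)).2 (by decide)
    exact ⟨_, ⟨hm, hk.trans hc⟩, hshift _ _ hn⟩
  · obtain ⟨⟨s', t'⟩, -, hn, hq, hc⟩ := specialColour_near s (by unfold OnSpecial at hst; omega) t
      (by unfold OnSpecial at hst; omega) hst _ _ i (h₂ a b h)
    obtain ⟨hm, hk⟩ : (12 * a + s', 12 * b + t') ∈ D.points ∧
        κ (12 * a + s', 12 * b + t') = specialColour (f a b) (f (a + 1) b) s' t' := by
      rcases hq with hq | ⟨rfl | rfl, rfl⟩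
      · refine ⟨⟨a, b, s', t', Or.inr (Or.inr (Or.inl ⟨h, hq⟩)), rfl⟩, ?_⟩
        unfold OnSpecial at hq
        rw [hκ _ _ _ _ (by omega) (by omega), cellColour, if_neg (by omega), if_pos (by omega),
          if_pos h]
      · simpa [hmid, hmid'] using hring a b 6 3 (hhu a b (Or.inr h)).1 (by decide)
      · simpa [hmid, hmid', mul_add] using
          hring (a + 1) b 0 3 (hhu a b (Or.inr h)).2 (by decide)
    exact ⟨_, ⟨hm, hk.trans hc⟩, hshift _ _ hn⟩
  · obtain ⟨ht, ht', rfl⟩ := hst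
    obtain ⟨⟨t', s'⟩, -, hn, hq, hc⟩ := plainColour_near t (by omega) ht (f a b) i
    obtain ⟨hm, hk⟩ : (12 * a + s', 12 * b + t') ∈ D.points ∧
        κ (12 * a + s', 12 * b + t') = plainColour (f a b) t' := by
      rcases hq with hq | ⟨hq | hq, hq'⟩
      · refine ⟨⟨a, b, s', t', Or.inr (Or.inr (Or.inr (Or.inl ⟨h, hq⟩))), rfl⟩, ?_⟩
        obtain ⟨hq, hq', hq''⟩ := hq
        simp only at hq hq' hq''
        rw [hκ _ _ _ _ (by omega) (by omega), cellColour, if_neg (by omega), if_neg (by omega),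
          if_neg (hv a b h)]
      · simp only at hq hq'
        subst hq hq'
        simpa [hmid] using hring a b 3 6 (hvu a b (Or.inl h)).1 (by decide)
      · simp only at hq hq'
        subst hq hq'
        simpa [hmid, mul_add, h₃ a b h] using
          hring a (b + 1) 3 0 (hvu a b (Or.inl h)).2 (by decide)
    exact ⟨_, ⟨hm, hk.trans hc⟩, hshift _ _ hn.swap⟩
  · obtain ⟨⟨t', s'⟩, -, hn, hq, hc⟩ := specialColour_near t (by unfold OnSpecial at hst; omega) s
      (by unfold OnSpecial at hst; omega) hst _ _ i (h₄ a b h)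
    obtain ⟨hm, hk⟩ : (12 * a + s', 12 * b + t') ∈ D.points ∧
        κ (12 * a + s', 12 * b + t') = specialColour (f a b) (f a (b + 1)) t' s' := by
      rcases hq with hq | ⟨hq | hq, hq'⟩
      · refine ⟨⟨a, b, s', t', Or.inr (Or.inr (Or.inr (Or.inr ⟨h, hq⟩))), rfl⟩, ?_⟩
        unfold OnSpecial at hq
        simp only at hq
        rw [hκ _ _ _ _ (by omega) (by omega), cellColour, if_neg (by omega), if_neg (by omega),
          if_pos h]
      · simp only at hq hq'
        subst hq hq'
        simpa [hmid, hmid'] using hring a b 3 6 (hvu a b (Or.inr h)).1 (by decide)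
      · simp only at hq hq'
        subst hq hq'
        simpa [hmid, hmid', mul_add] using
          hring a (b + 1) 3 0 (hvu a b (Or.inr h)).2 (by decide)
    exact ⟨_, ⟨hm, hk.trans hc⟩, hshift _ _ hn.swap⟩

end Layout

end CoverReduction

namespace CoverReduction

/-! ### The points printed for a drawing -/

/-! ### Items as wires and rings -/

section Items

/-- The point `z` is printed for one of the items `l`. -/
def Prints (l : List Item) (p q z : ℕ × ℕ) : Prop := ∃ i ∈ l, z = itemPoint p q i

theorem prints_append (l l' : List Item) (p q z : ℕ × ℕ) :
    Prints (l ++ l') p q z ↔ Prints l p q z ∨ Prints l' p q z := by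
  simp only [Prints, List.mem_append, or_and_right, exists_or]

theorem prints_ringItems (p q z : ℕ × ℕ) :
    Prints ringItems p q z ↔ ∃ s t, OnRing s t ∧ z = (12 * q.1 + s, 12 * q.2 + t) := by
  have hmem : ∀ i, i ∈ ringItems ↔ ∃ s t, OnRing s t ∧ (12, s, t) = i := by
    intro i
    simp only [ringItems, List.mem_map, List.mem_filter, Prod.exists, List.mem_product,
      List.mem_range, decide_eq_true_eq, OnRing, Nat.lt_succ_iff, and_assoc]
  constructor
  · rintro ⟨i, hi, rfl⟩
    obtain ⟨s, t, h, rfl⟩ := (hmem i).1 hi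
    exact ⟨s, t, h, by simp [itemPoint]⟩
  · rintro ⟨s, t, h, rfl⟩
    exact ⟨(12, s, t), (hmem _).2 ⟨s, t, h, rfl⟩, by simp [itemPoint]⟩

/-- A list of items invariant under `j ↦ 12 - j` draws the same wire whichever way the segment is
traversed. -/
theorem prints_comm {l : List Item} (h : ∀ i ∈ l, i.1 ≤ 12 ∧ (12 - i.1, i.2) ∈ l)
    (p q z : ℕ × ℕ) : Prints l p q z ↔ Prints l q p z := by
  have key : ∀ p q, Prints l p q z → Prints l q p z := by
    rintro p q ⟨i, hi, rfl⟩
    refine ⟨_, (h i hi).2, ?_⟩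
    have := (h i hi).1
    simp only [itemPoint, Nat.sub_sub_self this]
    ext <;> simp only <;> ring
  exact ⟨key p q, key q p⟩

theorem prints_right {l : List Item} {C : ℕ → ℕ → Prop}
    (h : ∀ i ∈ l, i.1 ≤ 12 ∧ C (i.1 + i.2.1) i.2.2)
    (h' : ∀ s t, C s t → ∃ i ∈ l, i.1 + i.2.1 = s ∧ i.2.2 = t) (a b : ℕ) (z : ℕ × ℕ) :
    Prints l (a, b) (a + 1, b) z ↔ ∃ s t, C s t ∧ z = (12 * a + s, 12 * b + t) := by
  have key : ∀ i ∈ l, itemPoint (a, b) (a + 1, b) i =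
      (12 * a + (i.1 + i.2.1), 12 * b + i.2.2) := by
    intro i hi
    obtain ⟨c, hc⟩ := Nat.exists_eq_add_of_le (h i hi).1
    simp only [itemPoint, hc, Nat.add_sub_cancel_left]
    ext <;> simp only <;> ring
  constructor
  · rintro ⟨i, hi, rfl⟩
    exact ⟨_, _, (h i hi).2, key i hi⟩
  · rintro ⟨s, t, hst, rfl⟩
    obtain ⟨i, hi, rfl, rfl⟩ := h' s t hst
    exact ⟨i, hi, (key i hi).symm⟩

theorem prints_up {l : List Item} {C : ℕ → ℕ → Prop}
    (h : ∀ i ∈ l, i.1 ≤ 12 ∧ C (i.1 + i.2.2) i.2.1)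
    (h' : ∀ s t, C s t → ∃ i ∈ l, i.1 + i.2.2 = s ∧ i.2.1 = t) (a b : ℕ) (z : ℕ × ℕ) :
    Prints l (a, b) (a, b + 1) z ↔ ∃ s t, C t s ∧ z = (12 * a + s, 12 * b + t) := by
  have key : ∀ i ∈ l, itemPoint (a, b) (a, b + 1) i =
      (12 * a + i.2.1, 12 * b + (i.1 + i.2.2)) := by
    intro i hi
    obtain ⟨c, hc⟩ := Nat.exists_eq_add_of_le (h i hi).1
    simp only [itemPoint, hc, Nat.add_sub_cancel_left]
    ext <;> simp only <;> ring
  constructor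
  · rintro ⟨i, hi, rfl⟩
    exact ⟨_, _, (h i hi).2, key i hi⟩
  · rintro ⟨s, t, hst, rfl⟩
    obtain ⟨i, hi, rfl, rfl⟩ := h' t s hst
    exact ⟨i, hi, (key i hi).symm⟩

theorem mem_plainItems_of_onPlain : ∀ s t, OnPlain s t →
    ∃ i ∈ plainItems, (i.1 + i.2.1 = s ∧ i.2.2 = t) ∧ (i.1 + i.2.2 = s ∧ i.2.1 = t) := by
  have : ∀ s < 12, ∀ t < 5, OnPlain s t →
      ∃ i ∈ plainItems, (i.1 + i.2.1 = s ∧ i.2.2 = t) ∧ (i.1 + i.2.2 = s ∧ i.2.1 = t) := by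
    decide
  exact fun s t h => this s (by unfold OnPlain at h; omega) t (by unfold OnPlain at h; omega) h

theorem mem_specialItems_of_onSpecial : ∀ s t, OnSpecial s t →
    (∃ i ∈ specialItems, i.1 + i.2.1 = s ∧ i.2.2 = t) ∧
      ∃ i ∈ specialItems, i.1 + i.2.2 = s ∧ i.2.1 = t := by
  have : ∀ s < 12, ∀ t < 5, OnSpecial s t →
      (∃ i ∈ specialItems, i.1 + i.2.1 = s ∧ i.2.2 = t) ∧
        ∃ i ∈ specialItems, i.1 + i.2.2 = s ∧ i.2.1 = t := by
    decide
  exact fun s t h => this s (by unfold OnSpecial at h; omega) t (by unfold OnSpecial at h; omega) h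

theorem prints_plainItems_comm (p q z : ℕ × ℕ) :
    Prints plainItems p q z ↔ Prints plainItems q p z :=
  prints_comm (by decide) p q z

theorem prints_specialItems_comm (p q z : ℕ × ℕ) :
    Prints specialItems p q z ↔ Prints specialItems q p z :=
  prints_comm (by decide) p q z

theorem prints_plainItems_right (a b : ℕ) (z : ℕ × ℕ) :
    Prints plainItems (a, b) (a + 1, b) z ↔
      ∃ s t, OnPlain s t ∧ z = (12 * a + s, 12 * b + t) :=
  prints_right (by decide)
    (fun s t h => (mem_plainItems_of_onPlain s t h).imp fun _ h => ⟨h.1, h.2.1⟩) a b z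

theorem prints_plainItems_up (a b : ℕ) (z : ℕ × ℕ) :
    Prints plainItems (a, b) (a, b + 1) z ↔
      ∃ s t, OnPlain t s ∧ z = (12 * a + s, 12 * b + t) :=
  prints_up (by decide)
    (fun s t h => (mem_plainItems_of_onPlain s t h).imp fun _ h => ⟨h.1, h.2.2⟩) a b z

theorem prints_specialItems_right (a b : ℕ) (z : ℕ × ℕ) :
    Prints specialItems (a, b) (a + 1, b) z ↔
      ∃ s t, OnSpecial s t ∧ z = (12 * a + s, 12 * b + t) :=
  prints_right (by decide) (fun s t h => (mem_specialItems_of_onSpecial s t h).1) a b z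

theorem prints_specialItems_up (a b : ℕ) (z : ℕ × ℕ) :
    Prints specialItems (a, b) (a, b + 1) z ↔
      ∃ s t, OnSpecial t s ∧ z = (12 * a + s, 12 * b + t) :=
  prints_up (by decide) (fun s t h => (mem_specialItems_of_onSpecial s t h).2) a b z

end Items

/-- The first step of the path `r` leads from `p` to `q`. -/
def FirstStep (r : List (ℕ × ℕ)) (p q : ℕ × ℕ) : Prop := ∃ l, r = p :: q :: l

/-- A later step of the path `r` leads from `p` to `q`. -/
def LaterStep (r : List (ℕ × ℕ)) (p q : ℕ × ℕ) : Prop := ∃ x l l', r = x :: l ++ p :: q :: l'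

theorem laterStep_cons_iff (x : ℕ × ℕ) (r : List (ℕ × ℕ)) (p q : ℕ × ℕ) :
    LaterStep (x :: r) p q ↔ FirstStep r p q ∨ LaterStep r p q := by
  constructor
  · rintro ⟨y, l, l', h⟩
    rw [List.cons_append, List.cons.injEq] at h
    obtain ⟨-, rfl⟩ := h
    rcases l with _ | ⟨y, l⟩
    · exact Or.inl ⟨l', rfl⟩
    · exact Or.inr ⟨y, l, l', rfl⟩
  · rintro (⟨l, rfl⟩ | ⟨y, l, l', rfl⟩)
    · exact ⟨x, [], l, rfl⟩
    · exact ⟨x, y :: l, l', rfl⟩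

/-- The hypothesis `hw` says that what the remaining tokens print does not depend on the state left
behind by this route. -/
theorem mem_printed_routeRest {w : List Token} {z : ℕ × ℕ} {Q : Prop}
    (hw : ∀ φ p, z ∈ printed φ p w ↔ Q) (r : List (ℕ × ℕ)) (p : ℕ × ℕ) :
    z ∈ printed .routeRest p (r.map .point ++ w) ↔ (∃ x y,
      (FirstStep (p :: r) x y ∨ LaterStep (p :: r) x y) ∧ Prints (items .routeRest) x y z) ∨
        Q := by
  induction r generalizing p with
  | nil => simp [hw, FirstStep, LaterStep]
  | cons q r ih =>
    have h : ∀ x y, FirstStep (p :: q :: r) x y ↔ p = x ∧ q = y := by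
      intro x y
      simp [FirstStep]
    have h' : z ∈ ((items .routeRest).map (itemPoint p q)).reverse ↔
        Prints (items .routeRest) p q z := by
      simp [Prints, eq_comm]
    simp only [List.map_cons, List.cons_append, printed, List.mem_append, Phase.next, ih,
      laterStep_cons_iff p, h, h']
    constructor
    · rintro ((⟨x, y, hs, hp⟩ | hQ) | hp)
      · exact Or.inl ⟨x, y, Or.inr hs, hp⟩
      · exact Or.inr hQ
      · exact Or.inl ⟨p, q, Or.inl ⟨rfl, rfl⟩, hp⟩
    · rintro (⟨x, y, ⟨rfl, rfl⟩ | hs, hp⟩ | hQ)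
      · exact Or.inr hp
      · exact Or.inl (Or.inl ⟨x, y, hs, hp⟩)
      · exact Or.inl (Or.inr hQ)

/-- The first point of a route prints nothing, so the point `p` read before the route has no
influence. -/
theorem mem_printed_route {w : List Token} {z : ℕ × ℕ} {Q : Prop}
    (hw : ∀ φ p, z ∈ printed φ p w ↔ Q) (r : List (ℕ × ℕ)) (φ : Phase) (p : ℕ × ℕ) :
    z ∈ printed φ p (.edge :: r.map .point ++ w) ↔ (∃ x y,
      (FirstStep r x y ∧ Prints (items .routeFirst) x y z) ∨
        (LaterStep r x y ∧ Prints (items .routeRest) x y z)) ∨ Q := by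
  rcases r with _ | ⟨a, _ | ⟨b, r⟩⟩
  · simp [printed, hw, FirstStep, LaterStep]
  · simp [printed, hw, FirstStep, LaterStep, items]
  · have h : ∀ x y, FirstStep (a :: b :: r) x y ↔ a = x ∧ b = y := by
      intro x y
      simp [FirstStep]
    have h' : z ∈ ((items .routeFirst).map (itemPoint a b)).reverse ↔
        Prints (items .routeFirst) a b z := by
      simp [Prints, eq_comm]
    have h'' : ((items .routeStart).map (itemPoint p a)).reverse = [] := rfl
    simp only [List.map_cons, List.cons_append, printed, List.mem_append, Phase.next,
      mem_printed_routeRest hw, laterStep_cons_iff a, h, h', h'', List.append_nil]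
    constructor
    · rintro ((⟨x, y, hs, hp⟩ | hQ) | hp)
      · exact Or.inl ⟨x, y, Or.inr ⟨hs, hp⟩⟩
      · exact Or.inr hQ
      · exact Or.inl ⟨a, b, Or.inl ⟨⟨rfl, rfl⟩, hp⟩⟩
    · rintro (⟨x, y, ⟨⟨rfl, rfl⟩, hp⟩ | ⟨hs, hp⟩⟩ | hQ)
      · exact Or.inr hp
      · exact Or.inl (Or.inl ⟨x, y, hs, hp⟩)
      · exact Or.inl (Or.inr hQ)

theorem mem_printed_routes (l : List (List (ℕ × ℕ))) (φ : Phase) (p z : ℕ × ℕ) :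
    z ∈ printed φ p (l.flatMap fun r => .edge :: r.map .point) ↔ ∃ r ∈ l, ∃ x y,
      (FirstStep r x y ∧ Prints (items .routeFirst) x y z) ∨
        (LaterStep r x y ∧ Prints (items .routeRest) x y z) := by
  induction l generalizing φ p with
  | nil => simp [printed]
  | cons r l ih =>
    rw [List.flatMap_cons, mem_printed_route ih]
    simp only [List.mem_cons, or_and_right, exists_or, exists_eq_left]

/-- Ring items have `j = 12`, so the previous point enters with coefficient 0 and may be replaced by
`v`. -/
theorem mem_printed_vertices {w : List Token} {z : ℕ × ℕ} {Q : Prop}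
    (hw : ∀ φ p, z ∈ printed φ p w ↔ Q) (l : List (ℕ × ℕ)) (φ : Phase) (p : ℕ × ℕ) :
    z ∈ printed φ p (l.flatMap (fun v => [.vertex, .point v]) ++ w) ↔
      (∃ v ∈ l, Prints ringItems v v z) ∨ Q := by
  induction l generalizing φ p with
  | nil => simp [hw]
  | cons v l ih =>
    have h : z ∈ ((items .vertex).map (itemPoint p v)).reverse ↔ Prints ringItems v v z := by
      rw [prints_ringItems, ← prints_ringItems p]
      simp [Prints, eq_comm, items]
    simp only [List.flatMap_cons, List.cons_append, List.nil_append, printed, List.mem_append, ih,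
      List.mem_cons, or_and_right, exists_or, exists_eq_left, h]
    rw [or_right_comm, or_comm (b := Prints ringItems v v z)]

end CoverReduction

namespace CoverReduction

/-! ### From drawings to layouts -/

/-! ### Steps of a route -/

section Paths

variable {r : List (ℕ × ℕ)} {p q : ℕ × ℕ}

theorem FirstStep.mem (h : FirstStep r p q) : p ∈ r ∧ q ∈ r := by
  obtain ⟨l, rfl⟩ := h
  simp

theorem LaterStep.mem (h : LaterStep r p q) : p ∈ r ∧ q ∈ r := by
  obtain ⟨x, l, l', rfl⟩ := h
  simp

theorem FirstStep.gridStep (h : FirstStep r p q) (hr : r.IsChain GridStep) : GridStep p q := by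
  obtain ⟨l, rfl⟩ := h
  exact (List.isChain_cons_cons.1 hr).1

theorem LaterStep.gridStep (h : LaterStep r p q) (hr : r.IsChain GridStep) : GridStep p q := by
  obtain ⟨x, l, l', rfl⟩ := h
  exact (List.isChain_cons_cons.1 (List.isChain_append.1 hr).2.1).1

theorem FirstStep.head (h : FirstStep r p q) : r.head? = some p := by
  obtain ⟨l, rfl⟩ := h
  rfl

theorem FirstStep.ne (h : FirstStep r p q) (hr : r.Nodup) : q ≠ p := by
  obtain ⟨l, rfl⟩ := h
  rintro rfl
  simp at hr

theorem LaterStep.ne_head (h : LaterStep r p q) (hr : r.Nodup) {x : ℕ × ℕ}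
    (hx : r.head? = some x) : p ≠ x ∧ q ≠ x := by
  obtain ⟨y, l, l', rfl⟩ := h
  simp only [List.cons_append, List.head?_cons, Option.some.injEq] at hx
  subst hx
  rw [List.cons_append, List.nodup_cons] at hr
  constructor <;> rintro rfl <;> simp at hr

/-- Rings along a route are printed only at the ends of steps; the one at the head is printed with
the vertices. -/
theorem eq_head_or_step {x : ℕ × ℕ} (hx : x ∈ r) :
    r.head? = some x ∨ ∃ p, FirstStep r p x ∨ LaterStep r p x := by
  obtain ⟨l, l', rfl⟩ := List.append_of_mem hx
  rcases List.eq_nil_or_concat l with rfl | ⟨l, p, rfl⟩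
  · exact Or.inl rfl
  · refine Or.inr ⟨p, ?_⟩
    rcases l with _ | ⟨y, l⟩
    · exact Or.inl ⟨l', by simp⟩
    · exact Or.inr ⟨y, l, l', by simp⟩

theorem eq_of_forall_step {α : Type} (f : ℕ × ℕ → α) (x : ℕ × ℕ) (l : List (ℕ × ℕ))
    (h : ∀ p q, FirstStep (x :: l) p q ∨ LaterStep (x :: l) p q → f p = f q) (y : ℕ × ℕ)
    (hy : y ∈ x :: l) : f x = f y := by
  induction l generalizing x with
  | nil => simp_all
  | cons z l ih =>
    rcases List.mem_cons.1 hy with rfl | hy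
    · rfl
    · refine (h x z (Or.inl ⟨l, rfl⟩)).trans (ih z (fun p q hpq => h p q ?_) hy)
      rw [laterStep_cons_iff]
      exact Or.inr hpq

end Paths

/-! ### The layout of a drawing and its colourings -/

section Drawing

variable {n : ℕ} {G : SimpleGraph (Fin n)} (D : OrthogonalDrawing G)

/-- A grid point that is used by the drawing. -/
def UsedPoint (p : ℕ × ℕ) : Prop :=
  (∃ v, D.pos v = p) ∨ ∃ u v, IsOrderedEdge G u v ∧ p ∈ D.route u v

/-- The first step of a route. -/
def SpecialSegment (p q : ℕ × ℕ) : Prop :=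
  ∃ u v, IsOrderedEdge G u v ∧ FirstStep (D.route u v) p q

/-- A later step of a route. -/
def PlainSegment (p q : ℕ × ℕ) : Prop :=
  ∃ u v, IsOrderedEdge G u v ∧ LaterStep (D.route u v) p q

/-- The layout of a drawing. -/
def layout : Layout where
  used a b := UsedPoint D (a, b)
  hplain a b := PlainSegment D (a, b) (a + 1, b) ∨ PlainSegment D (a + 1, b) (a, b)
  hspecial a b := SpecialSegment D (a, b) (a + 1, b) ∨ SpecialSegment D (a + 1, b) (a, b)
  vplain a b := PlainSegment D (a, b) (a, b + 1) ∨ PlainSegment D (a, b + 1) (a, b)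
  vspecial a b := SpecialSegment D (a, b) (a, b + 1) ∨ SpecialSegment D (a, b + 1) (a, b)

variable {D}

theorem SpecialSegment.used {p q : ℕ × ℕ} (h : SpecialSegment D p q) :
    UsedPoint D p ∧ UsedPoint D q := by
  obtain ⟨u, v, he, h⟩ := h
  exact ⟨Or.inr ⟨u, v, he, h.mem.1⟩, Or.inr ⟨u, v, he, h.mem.2⟩⟩

theorem PlainSegment.used {p q : ℕ × ℕ} (h : PlainSegment D p q) :
    UsedPoint D p ∧ UsedPoint D q := by
  obtain ⟨u, v, he, h⟩ := h
  exact ⟨Or.inr ⟨u, v, he, h.mem.1⟩, Or.inr ⟨u, v, he, h.mem.2⟩⟩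

theorem SpecialSegment.gridStep {p q : ℕ × ℕ} (h : SpecialSegment D p q) : GridStep p q := by
  obtain ⟨u, v, he, h⟩ := h
  exact h.gridStep (D.route_step u v he)

theorem PlainSegment.gridStep {p q : ℕ × ℕ} (h : PlainSegment D p q) : GridStep p q := by
  obtain ⟨u, v, he, h⟩ := h
  exact h.gridStep (D.route_step u v he)

/-- Within one route, a later step never returns to the head. If two different routes shared a
segment, both its ends would be vertices, hence the two endpoints of both edges; as edges are
ordered, they would coincide. -/
theorem not_plain_of_special {p q x y : ℕ × ℕ} (h : SpecialSegment D p q)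
    (h' : PlainSegment D x y) (hxy : (x = p ∧ y = q) ∨ (x = q ∧ y = p)) : False := by
  obtain ⟨u, v, he, h⟩ := h
  obtain ⟨u', v', he', h'⟩ := h'
  by_cases hne : (u, v) = (u', v')
  · obtain ⟨rfl, rfl⟩ := Prod.mk.inj hne
    have := h'.ne_head (D.route_simple u v he) h.head
    tauto
  · have hmem : p ∈ D.route u' v' ∧ q ∈ D.route u' v' := by
      have := h'.mem
      rcases hxy with ⟨rfl, rfl⟩ | ⟨rfl, rfl⟩
      · exact this
      · exact this.symm
    have hpq := h.ne (D.route_simple u v he)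
    obtain ⟨w, hw⟩ := D.route_meet u v u' v' he he' hne p h.mem.1 hmem.1
    obtain ⟨w', hw'⟩ := D.route_meet u v u' v' he he' hne q h.mem.2 hmem.2
    have hww : w ≠ w' := by
      rintro rfl
      exact hpq (hw'.trans hw.symm)
    have e₁ := D.route_avoids u v he w (hw ▸ h.mem.1)
    have e₂ := D.route_avoids u v he w' (hw' ▸ h.mem.2)
    have e₃ := D.route_avoids u' v' he' w (hw ▸ hmem.1)
    have e₄ := D.route_avoids u' v' he' w' (hw' ▸ hmem.2)
    have l₁ := he.1
    have l₂ := he'.1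
    apply hne
    rw [Prod.mk.injEq]
    omega

theorem layout_hplain (a b : ℕ) (h : (layout D).hplain a b) : ¬ (layout D).hspecial a b := by
  rintro (h' | h') <;> rcases h with h | h <;> exact not_plain_of_special h' h (by simp)

theorem layout_vplain (a b : ℕ) (h : (layout D).vplain a b) : ¬ (layout D).vspecial a b := by
  rintro (h' | h') <;> rcases h with h | h <;> exact not_plain_of_special h' h (by simp)

theorem layout_h_used (a b : ℕ) (h : (layout D).hplain a b ∨ (layout D).hspecial a b) :
    (layout D).used a b ∧ (layout D).used (a + 1) b := by
  rcases h with (h | h) | (h | h)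
  exacts [h.used, h.used.symm, h.used, h.used.symm]

theorem layout_v_used (a b : ℕ) (h : (layout D).vplain a b ∨ (layout D).vspecial a b) :
    (layout D).used a b ∧ (layout D).used a (b + 1) := by
  rcases h with (h | h) | (h | h)
  exacts [h.used, h.used.symm, h.used, h.used.symm]

/-- A grid step leads to the right, to the left, up or down. -/
theorem GridStep.cases {p q : ℕ × ℕ} (h : GridStep p q) {C : ℕ × ℕ → ℕ × ℕ → Prop}
    (h₁ : ∀ a b, C (a, b) (a + 1, b)) (h₂ : ∀ a b, C (a + 1, b) (a, b))
    (h₃ : ∀ a b, C (a, b) (a, b + 1)) (h₄ : ∀ a b, C (a, b + 1) (a, b)) : C p q := by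
  obtain ⟨a, b⟩ := p
  obtain ⟨c, d⟩ := q
  rcases h with ⟨h, h' | h'⟩ | ⟨h, h' | h'⟩ <;> simp only at h h' <;> subst h h'
  exacts [h₁ _ _, h₂ _ _, h₃ _ _, h₄ _ _]

/-! #### The points printed are those of the layout -/

theorem PlainSegment.mem_points {p q z : ℕ × ℕ} (h : PlainSegment D p q)
    (hz : Prints plainItems p q z) : z ∈ (layout D).points := by
  refine GridStep.cases h.gridStep
    (C := fun p q => PlainSegment D p q → Prints plainItems p q z → z ∈ (layout D).points)
    ?_ ?_ ?_ ?_ h hz <;> intro a b h hz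
  · obtain ⟨s, t, hst, rfl⟩ := (prints_plainItems_right a b z).1 hz
    exact ⟨a, b, s, t, Or.inr (Or.inl ⟨Or.inl h, hst⟩), rfl⟩
  · rw [prints_plainItems_comm] at hz
    obtain ⟨s, t, hst, rfl⟩ := (prints_plainItems_right a b z).1 hz
    exact ⟨a, b, s, t, Or.inr (Or.inl ⟨Or.inr h, hst⟩), rfl⟩
  · obtain ⟨s, t, hst, rfl⟩ := (prints_plainItems_up a b z).1 hz
    exact ⟨a, b, s, t, Or.inr (Or.inr (Or.inr (Or.inl ⟨Or.inl h, hst⟩))), rfl⟩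
  · rw [prints_plainItems_comm] at hz
    obtain ⟨s, t, hst, rfl⟩ := (prints_plainItems_up a b z).1 hz
    exact ⟨a, b, s, t, Or.inr (Or.inr (Or.inr (Or.inl ⟨Or.inr h, hst⟩))), rfl⟩

theorem SpecialSegment.mem_points {p q z : ℕ × ℕ} (h : SpecialSegment D p q)
    (hz : Prints specialItems p q z) : z ∈ (layout D).points := by
  refine GridStep.cases h.gridStep
    (C := fun p q => SpecialSegment D p q → Prints specialItems p q z → z ∈ (layout D).points)
    ?_ ?_ ?_ ?_ h hz <;> intro a b h hz
  · obtain ⟨s, t, hst, rfl⟩ := (prints_specialItems_right a b z).1 hz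
    exact ⟨a, b, s, t, Or.inr (Or.inr (Or.inl ⟨Or.inl h, hst⟩)), rfl⟩
  · rw [prints_specialItems_comm] at hz
    obtain ⟨s, t, hst, rfl⟩ := (prints_specialItems_right a b z).1 hz
    exact ⟨a, b, s, t, Or.inr (Or.inr (Or.inl ⟨Or.inr h, hst⟩)), rfl⟩
  · obtain ⟨s, t, hst, rfl⟩ := (prints_specialItems_up a b z).1 hz
    exact ⟨a, b, s, t, Or.inr (Or.inr (Or.inr (Or.inr ⟨Or.inl h, hst⟩))), rfl⟩
  · rw [prints_specialItems_comm] at hz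
    obtain ⟨s, t, hst, rfl⟩ := (prints_specialItems_up a b z).1 hz
    exact ⟨a, b, s, t, Or.inr (Or.inr (Or.inr (Or.inr ⟨Or.inr h, hst⟩))), rfl⟩

theorem UsedPoint.mem_points {p q z : ℕ × ℕ} (h : UsedPoint D q) (hz : Prints ringItems p q z) :
    z ∈ (layout D).points := by
  obtain ⟨s, t, hst, rfl⟩ := (prints_ringItems p q z).1 hz
  exact ⟨q.1, q.2, s, t, Or.inl ⟨h, hst⟩, rfl⟩

/-- The points printed for a drawing. -/
def PrintedPoint (D : OrthogonalDrawing G) (z : ℕ × ℕ) : Prop :=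
  (∃ v, Prints ringItems (D.pos v) (D.pos v) z) ∨ ∃ u v, IsOrderedEdge G u v ∧ ∃ x y,
    (FirstStep (D.route u v) x y ∧ Prints (items .routeFirst) x y z) ∨
      (LaterStep (D.route u v) x y ∧ Prints (items .routeRest) x y z)

theorem UsedPoint.printed {q z : ℕ × ℕ} (h : UsedPoint D q) (hz : Prints ringItems q q z) :
    PrintedPoint D z := by
  have hq : ∀ p, Prints ringItems p q z := fun p => by
    rwa [prints_ringItems, ← prints_ringItems q]
  rcases h with ⟨v, rfl⟩ | ⟨u, v, he, hm⟩
  · exact Or.inl ⟨v, hz⟩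
  rcases eq_head_or_step hm with h | ⟨p, h | h⟩
  · rw [D.route_head u v he, Option.some.injEq] at h
    subst h
    exact Or.inl ⟨u, hz⟩
  · exact Or.inr ⟨u, v, he, p, q, Or.inl ⟨h, (prints_append _ _ _ _ _).2 (Or.inr (hq p))⟩⟩
  · exact Or.inr ⟨u, v, he, p, q, Or.inr ⟨h, (prints_append _ _ _ _ _).2 (Or.inr (hq p))⟩⟩

theorem PlainSegment.printed {p q z : ℕ × ℕ} (h : PlainSegment D p q)
    (hz : Prints plainItems p q z) : PrintedPoint D z := by
  obtain ⟨u, v, he, h⟩ := h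
  exact Or.inr ⟨u, v, he, p, q, Or.inr ⟨h, (prints_append _ _ _ _ _).2 (Or.inl hz)⟩⟩

theorem SpecialSegment.printed {p q z : ℕ × ℕ} (h : SpecialSegment D p q)
    (hz : Prints specialItems p q z) : PrintedPoint D z := by
  obtain ⟨u, v, he, h⟩ := h
  exact Or.inr ⟨u, v, he, p, q, Or.inl ⟨h, (prints_append _ _ _ _ _).2 (Or.inl hz)⟩⟩

theorem printedPoint_iff (z : ℕ × ℕ) : PrintedPoint D z ↔ z ∈ (layout D).points := by
  constructor
  · rintro (⟨v, hz⟩ | ⟨u, v, he, x, y, ⟨h, hz⟩ | ⟨h, hz⟩⟩)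
    · exact UsedPoint.mem_points (Or.inl ⟨v, rfl⟩) hz
    · rcases (prints_append _ _ _ _ _).1 hz with hz | hz
      · exact SpecialSegment.mem_points ⟨u, v, he, h⟩ hz
      · exact UsedPoint.mem_points (Or.inr ⟨u, v, he, h.mem.2⟩) hz
    · rcases (prints_append _ _ _ _ _).1 hz with hz | hz
      · exact PlainSegment.mem_points ⟨u, v, he, h⟩ hz
      · exact UsedPoint.mem_points (Or.inr ⟨u, v, he, h.mem.2⟩) hz
  · rintro ⟨a, b, s, t, ⟨h, hst⟩ | ⟨h | h, hst⟩ | ⟨h | h, hst⟩ | ⟨h | h, hst⟩ | ⟨h | h, hst⟩, rfl⟩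
    · exact UsedPoint.printed h ((prints_ringItems _ _ _).2 ⟨s, t, hst, rfl⟩)
    · exact h.printed ((prints_plainItems_right a b _).2 ⟨s, t, hst, rfl⟩)
    · exact h.printed ((prints_plainItems_comm _ _ _).1
        ((prints_plainItems_right a b _).2 ⟨s, t, hst, rfl⟩))
    · exact h.printed ((prints_specialItems_right a b _).2 ⟨s, t, hst, rfl⟩)
    · exact h.printed ((prints_specialItems_comm _ _ _).1
        ((prints_specialItems_right a b _).2 ⟨s, t, hst, rfl⟩))
    · exact h.printed ((prints_plainItems_up a b _).2 ⟨s, t, hst, rfl⟩)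
    · exact h.printed ((prints_plainItems_comm _ _ _).1
        ((prints_plainItems_up a b _).2 ⟨s, t, hst, rfl⟩))
    · exact h.printed ((prints_specialItems_up a b _).2 ⟨s, t, hst, rfl⟩)
    · exact h.printed ((prints_specialItems_comm _ _ _).1
        ((prints_specialItems_up a b _).2 ⟨s, t, hst, rfl⟩))

/-! #### Colourings -/

theorem exists_route_eq {u v : Fin n} (he : IsOrderedEdge G u v) :
    ∃ q l, D.route u v = D.pos u :: q :: l ∧ D.pos v ∈ q :: l := by
  have h₁ := D.route_head u v he
  have h₂ := D.route_last u v he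
  have hne : D.pos u ≠ D.pos v := fun h => he.1.ne (D.pos_injective h)
  rcases h : D.route u v with _ | ⟨p, _ | ⟨q, l⟩⟩
  · simp [h] at h₁
  · simp only [h, List.head?_cons, List.getLast?_singleton, Option.some.injEq] at h₁ h₂
    exact absurd (h₁.symm.trans h₂) hne
  · simp only [h, List.head?_cons, List.getLast?_cons_cons, Option.some.injEq] at h₁ h₂
    subst h₁
    exact ⟨q, l, rfl, List.mem_of_getLast? h₂⟩

/-- Along a route the colour changes at the first step and is constant afterwards, so it differs at
the two endpoints. -/
theorem colorable_of_isTriple {T : Fin 3 → Set (ℕ × ℕ)} (hT : IsTriple (layout D).points T) :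
    G.Colorable 3 := by
  obtain ⟨f, h₁, h₂, h₃, h₄⟩ := Layout.exists_colouring_of_isTriple layout_hplain layout_vplain
    layout_h_used layout_v_used hT
  have hplain : ∀ p q, PlainSegment D p q → f p.1 p.2 = f q.1 q.2 := by
    intro p q h
    refine GridStep.cases h.gridStep (C := fun p q => PlainSegment D p q → f p.1 p.2 = f q.1 q.2)
      ?_ ?_ ?_ ?_ h <;> intro a b h
    exacts [h₁ a b (Or.inl h), (h₁ a b (Or.inr h)).symm, h₃ a b (Or.inl h),
      (h₃ a b (Or.inr h)).symm]
  have hspecial : ∀ p q, SpecialSegment D p q → f p.1 p.2 ≠ f q.1 q.2 := by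
    intro p q h
    refine GridStep.cases h.gridStep (C := fun p q => SpecialSegment D p q → f p.1 p.2 ≠ f q.1 q.2)
      ?_ ?_ ?_ ?_ h <;> intro a b h
    exacts [h₂ a b (Or.inl h), (h₂ a b (Or.inr h)).symm, h₄ a b (Or.inl h),
      (h₄ a b (Or.inr h)).symm]
  have key : ∀ u v, IsOrderedEdge G u v →
      f (D.pos u).1 (D.pos u).2 ≠ f (D.pos v).1 (D.pos v).2 := by
    intro u v he
    obtain ⟨q, l, hr, hv⟩ := exists_route_eq (D := D) he
    have e₁ := hspecial (D.pos u) q ⟨u, v, he, l, hr⟩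
    have e₂ := eq_of_forall_step (fun p => f p.1 p.2) q l (fun x y hxy => hplain x y
      ⟨u, v, he, by rw [hr, laterStep_cons_iff]; exact hxy⟩) _ hv
    exact fun h => e₁ (h.trans e₂.symm)
  refine ⟨SimpleGraph.Coloring.mk (fun v => f (D.pos v).1 (D.pos v).2) fun {u v} huv => ?_⟩
  rcases lt_or_gt_of_ne huv.ne with h | h
  · exact key u v ⟨h, huv⟩
  · exact (key v u ⟨h, huv.symm⟩).symm

open Classical in
/-- The colours of the grid points, given the colours of the vertices. -/
noncomputable def gridColour (D : OrthogonalDrawing G) (f : Fin n → Fin 3) (p : ℕ × ℕ) : Fin 3 :=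
  if h : ∃ w, D.pos w = p then f h.choose
  else if h : ∃ v u, IsOrderedEdge G u v ∧ p ∈ D.route u v then f h.choose
  else 0

theorem gridColour_pos (f : Fin n → Fin 3) (w : Fin n) : gridColour D f (D.pos w) = f w := by
  have h : ∃ w', D.pos w' = D.pos w := ⟨w, rfl⟩
  rw [gridColour, dif_pos h, D.pos_injective h.choose_spec]

/-- If the choice in `gridColour` produced a vertex other than `v`, then `p` would lie on two
different routes and hence be a vertex, a case treated separately. -/
theorem gridColour_route (f : Fin n → Fin 3) {u v : Fin n} (he : IsOrderedEdge G u v)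
    {p : ℕ × ℕ} (hp : p ∈ D.route u v) (hne : p ≠ D.pos u) : gridColour D f p = f v := by
  by_cases h : ∃ w, D.pos w = p
  · obtain ⟨w, rfl⟩ := h
    rw [gridColour_pos]
    rcases D.route_avoids u v he w hp with rfl | rfl
    · exact absurd rfl hne
    · rfl
  · have h' : ∃ v u, IsOrderedEdge G u v ∧ p ∈ D.route u v := ⟨v, u, he, hp⟩
    rw [gridColour, dif_neg h, dif_pos h']
    obtain ⟨u', he', hp'⟩ := h'.choose_spec
    by_contra hf
    obtain ⟨w, hw⟩ := D.route_meet u v u' _ he he' (fun hh => hf (by rw [← (Prod.mk.inj hh).2]))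
      p hp hp'
    exact h ⟨w, hw.symm⟩

theorem exists_isTriple_of_colorable (h : G.Colorable 3) :
    ∃ T, IsTriple (layout D).points T := by
  obtain ⟨c⟩ := h
  have hplain : ∀ p q, PlainSegment D p q → gridColour D c p = gridColour D c q := by
    rintro p q ⟨u, v, he, h⟩
    have hne := h.ne_head (D.route_simple u v he) (D.route_head u v he)
    rw [gridColour_route c he h.mem.1 hne.1, gridColour_route c he h.mem.2 hne.2]
  have hspecial : ∀ p q, SpecialSegment D p q → gridColour D c p ≠ gridColour D c q := by
    rintro p q ⟨u, v, he, h⟩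
    have hp : D.pos u = p := by simpa [D.route_head u v he] using h.head
    have hne := h.ne (D.route_simple u v he)
    rw [gridColour_route c he h.mem.2 (hp ▸ hne), ← hp, gridColour_pos]
    exact c.valid he.2
  refine (layout D).exists_isTriple layout_hplain layout_vplain layout_h_used layout_v_used
    (fun a b => gridColour D c (a, b)) ?_ ?_ ?_ ?_
  · rintro a b (h | h)
    exacts [hplain _ _ h, (hplain _ _ h).symm]
  · rintro a b (h | h)
    exacts [hspecial _ _ h, (hspecial _ _ h).symm]
  · rintro a b (h | h)
    exacts [hplain _ _ h, (hplain _ _ h).symm]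
  · rintro a b (h | h)
    exacts [hspecial _ _ h, (hspecial _ _ h).symm]

/-! #### The input -/

variable (D)

/-- The input as a sequence of tokens. -/
noncomputable def tokens : List Token :=
  ((List.finRange n).map D.pos).flatMap (fun v => [.vertex, .point v]) ++
    ((orderedEdges G).map fun e => D.route e.1 e.2).flatMap fun r => .edge :: r.map .point

theorem flatMap_encodeToken_tokens : (tokens D).flatMap encodeToken = D.encode := by
  simp [tokens, OrthogonalDrawing.encode, List.flatMap_assoc, List.flatMap_map, encodeToken]

theorem mem_orderedEdges (e : Fin n × Fin n) : e ∈ orderedEdges G ↔ IsOrderedEdge G e.1 e.2 := by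
  obtain ⟨u, v⟩ := e
  simp [orderedEdges]

theorem mem_printed_tokens (z : ℕ × ℕ) :
    z ∈ printed .vertex (0, 0) (tokens D) ↔ z ∈ (layout D).points := by
  rw [tokens, mem_printed_vertices (fun φ p => mem_printed_routes _ φ p z), ← printedPoint_iff]
  simp [PrintedPoint, mem_orderedEdges]

/-! ### The length of the input -/

theorem length_encodeGridPoint_le {p : ℕ × ℕ} {N : ℕ} (h₁ : p.1 ≤ N) (h₂ : p.2 ≤ N) :
    (encodeGridPoint p).length ≤ 2 * N + 2 := by
  have e₁ := length_bits_le p.1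
  have e₂ := length_bits_le p.2
  simp [encodeGridPoint, encodeNatural]
  omega

theorem length_flatMap_le {α β : Type} (l : List α) (f : α → List β) {N : ℕ}
    (h : ∀ a ∈ l, (f a).length ≤ N) : (l.flatMap f).length ≤ l.length * N := by
  rw [List.length_flatMap]
  simpa using List.sum_le_card_nsmul (l.map fun a => (f a).length) N (by simpa using h)

/-- A route repeats no point, so its length is at most the area. Each side of a nonempty grid is at
most the area too, which bounds the coordinates; bounding the number of digits of a number by the
number itself suffices. -/
theorem length_encode_le {w h N : ℕ} (hD : D.LiesOnGrid w h) (hN : w * h ≤ N) :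
    D.encode.length ≤ n * (2 * N + 3) + n ^ 2 * (N * (2 * N + 2) + 1) := by
  have hp : ∀ p : ℕ × ℕ, p.1 < w ∧ p.2 < h → p.1 ≤ N ∧ p.2 ≤ N := by
    intro p hp
    constructor <;> nlinarith
  have h₁ : ((List.finRange n).flatMap
      (fun v => Letter.vertex :: encodeGridPoint (D.pos v))).length ≤ n * (2 * N + 3) := by
    refine (length_flatMap_le _ _ (N := 2 * N + 3) fun v _ => ?_).trans (by simp)
    have := hp _ (hD.1 v)
    have := length_encodeGridPoint_le this.1 this.2
    simp
    omega
  have h₂ : ((orderedEdges G).flatMap fun e =>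
      Letter.edge :: (D.route e.1 e.2).flatMap encodeGridPoint).length ≤
      n ^ 2 * (N * (2 * N + 2) + 1) := by
    refine (length_flatMap_le _ _ (N := N * (2 * N + 2) + 1) fun e he => ?_).trans
      (Nat.mul_le_mul_right _ ?_)
    · rw [mem_orderedEdges] at he
      have hlen : (D.route e.1 e.2).length ≤ N := by
        have hs : (D.route e.1 e.2).toFinset ⊆ Finset.range w ×ˢ Finset.range h := by
          intro p hp'
          simpa using hD.2 _ _ he p (by simpa using hp')
        have := Finset.card_le_card hs
        rw [List.toFinset_card_of_nodup (D.route_simple _ _ he)] at this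
        simp at this
        omega
      have := length_flatMap_le (D.route e.1 e.2) encodeGridPoint (N := 2 * N + 2)
        fun p hp' => by
          have := hp p (hD.2 _ _ he p hp')
          exact length_encodeGridPoint_le this.1 this.2
      have := Nat.mul_le_mul_right (2 * N + 2) hlen
      simp only [List.length_cons]
      omega
    · have : (orderedEdges G).length ≤ (List.finRange n ×ˢ List.finRange n).length :=
        List.length_filter_le _ _
      rw [List.length_product] at this
      simpa [sq] using this
  rw [OrthogonalDrawing.encode, List.length_append]
  exact Nat.add_le_add h₁ h₂

end Drawing

end CoverReduction

open CoverReduction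

theorem mainTheorem2 :
    ∃ M : Turing.TM2ComputableAux Letter Letter,
      ∀ C : ℕ, ∃ time : Polynomial ℕ,
        ∀ (n : ℕ) (G : SimpleGraph (Fin n)) (D : OrthogonalDrawing G) (w h : ℕ),
          D.LiesOnGrid w h → w * h ≤ C * n ^ 2 →
          ∃ L : List (ℚ × ℚ),
            HaltsWithOutputIn M D.encode (encodePoints L) (time.eval n) ∧
            ∀ r : ℝ, 1 ≤ r → r < Real.sqrt 2 →
              (HasSolidarityCover (planeSet L) 3 r ↔ G.Colorable 3) := by
  -- The time bound `10000 * (N + 1) ^ 2` for an input of length at most `N`, with `N` taken from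
  -- `length_encode_le` for the area bound `C * n ^ 2`.
  refine ⟨machine, fun C => ⟨10000 * (.X * (2 * ((C : Polynomial ℕ) * .X ^ 2) + 3) +
    .X ^ 2 * (((C : Polynomial ℕ) * .X ^ 2) * (2 * ((C : Polynomial ℕ) * .X ^ 2) + 2) + 1) +
      1) ^ 2, ?_⟩⟩
  intro n G D w h hD hwh
  refine ⟨(printed .vertex (0, 0) (tokens D)).map toRat, ?_, fun r hr hr' => ?_⟩
  · have := haltsWithOutputIn_machine (tokens D) (N := n * (2 * (C * n ^ 2) + 3) +
      n ^ 2 * ((C * n ^ 2) * (2 * (C * n ^ 2) + 2) + 1))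
      (by rw [flatMap_encodeToken_tokens]; exact length_encode_le D hD hwh)
    rw [flatMap_encodeToken_tokens] at this
    simpa using this
  · have hS : planeSet ((printed .vertex (0, 0) (tokens D)).map toRat) =
        toPlane '' (layout D).points := by
      ext x
      constructor
      · rintro ⟨p, hp, rfl⟩
        obtain ⟨z, hz, rfl⟩ := List.mem_map.1 hp
        exact ⟨z, (mem_printed_tokens D z).1 hz, by simp [toPlane, toRat]⟩
      · rintro ⟨z, hz, rfl⟩
        exact ⟨toRat z, List.mem_map_of_mem ((mem_printed_tokens D z).2 hz),
          by simp [toPlane, toRat]⟩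
    rw [hS, hasSolidarityCover_image_iff hr hr']
    exact ⟨fun ⟨_, hT⟩ => colorable_of_isTriple hT, exists_isTriple_of_colorable⟩
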